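/- **Theorem 2 (Equivalence with the GGE).** Let $S$ be a quantum system with a Hilbert space of finite dimension $d\ge 1$, let $n\ge 1$, let $\mathcal Q=(Q^1,\dots,Q^n)$ be pairwise commuting observables (Hermitian operators) of $S$, and let $\boldsymbol\beta=(\beta^1,\dots,\beta^n)\in\mathbb R^n$ with $\beta^j\neq 0$ for all $j$. *Notation.* For commuting observables $\mathcal A=(A^1,\dots,A^n)$ of a finite-dimensional system, $\mathbf w\in\mathbb R^n$ and $\boldsymbol\lambda\in\mathbb R^n$, write $$[\mathbf w]_{\mathcal A}=\{\rho \text{ density matrix}:\operatorname{tr}(\rho A^j)=w^j\ \text{for all } j\},\qquad \gamma_{\boldsymbol\lambda}(\mathcal A)=\frac{e^{-\sum_j\lambda^jA^j}}{\operatorname{tr}\, e^{-\sum_j\lambda^jA^j}} .$$ For a vector $\mathbf v=(v^1,\dots,v^n)\in\mathbb R^n$, a generalised Gibbs ensemble (GGE) of the macrostate $(\mathbf v,\mathcal Q)$, denoted $\gamma_{\mathbf v}(\mathcal Q)$, is a state with $\operatorname{tr}(\gamma_{\mathbf v}(\mathcal Q)\,Q^j)=v^j$ for all $j$ that is of the form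 $\gamma_{\boldsymbol\lambda}(\mathcal Q)$ with $\boldsymbol\lambda\in\mathbb R^n$ or a limit of such states (limits, i.e. infinite multipliers, are needed only for extremal $\mathbf v$). An environment $E$ consists of finitely many systems $E^1,\dots,E^N$ of arbitrary finite positive dimensions, each with arbitrary pairwise commuting observables $\mathcal Q_{E^l}=(Q^1_{E^l},\dots,Q^n_{E^l})$. Put $Q^j_{SE}=Q^j+\sum_{l}Q^j_{E^l}$ (each summand acting on its own tensor factor), $v_{\boldsymbol\beta}(Q^j_{E^l})=\operatorname{tr}(\gamma_{\boldsymbol\beta}(\mathcal Q_{E^l})Q^j_{E^l})$ and $\mathbf v_{\boldsymbol\beta}(\mathcal Q_{E^l})=(v_{\boldsymbol\beta}(Q^1_{E^l}),\dots,v_{\boldsymbol\beta}(Q^n_{E^l}))$. For a unitary $U$ on $SE$, states $\rho$ of $S$, $\sigma_l$ of $E^l$ and $\rho_f$ of $S$, consider, with $\omega=\rho\otimes\sigma_1\otimes\cdots\otimes\sigma_N$, $$(\ast)\quad \big\|\operatorname{Tr}_E(U\omega U^\dagger)-\rho_f\big\|_1\le\epsilon\quad\text{and}\quad \big|\operatorname{tr}(U\omega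 U^\dagger Q^j_{SE})-\operatorname{tr}(\omega\, Q^j_{SE})\big|\le\epsilon'\ \text{ for all } j .$$ *Macrostate operations:* $(\mathbf v,\mathcal Q)\xrightarrow{\boldsymbol\beta\text{-mac}}\rho_f$ means that for all $\epsilon,\epsilon'>0$ there are an environment and a unitary $U$ on $SE$ such that $(\ast)$ holds simultaneously for all $\rho\in[\mathbf v]_{\mathcal Q}$ and all $\sigma_l\in[\mathbf v_{\boldsymbol\beta}(\mathcal Q_{E^l})]_{\mathcal Q_{E^l}}$, $l=1,\dots,N$. *Microstate operations:* $\rho\xrightarrow{\boldsymbol\beta\text{-mic}}\rho_f$ means that for all $\epsilon,\epsilon'>0$ there are an environment and a unitary $U$ on $SE$ such that $(\ast)$ holds for $\rho$ and $\sigma_l=\gamma_{\boldsymbol\beta}(\mathcal Q_{E^l})$, $l=1,\dots,N$. *Claim.* If $\gamma_{\mathbf v}(\mathcal Q)$ is a GGE of $(\mathbf v,\mathcal Q)$, then the macrostate $(\mathbf v,\mathcal Q)$ is operationally equivalent to it: for every density matrix $\rho_f$ of $S$, $$(\mathbf v,\mathcal Q)\xrightarrow{\boldsymbol\beta\text{-mac}}\rho_f\iff\gamma_{\mathbf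 v}(\mathcal Q)\xrightarrow{\boldsymbol\beta\text{-mic}}\rho_f .$$ -/

import Mathlib

open scoped Kronecker Matrix ComplexOrder

noncomputable section

/-- A density matrix (microstate): positive semidefinite with unit trace. -/
def IsDensityMatrix {ι : Type*} [Fintype ι] (ρ : Matrix ι ι ℂ) : Prop :=
  ρ.PosSemidef ∧ ρ.trace = 1

/-- A tuple of pairwise commuting observables (Hermitian matrices). -/
def IsCommutingObservables {ι : Type*} [Fintype ι] {n : ℕ}
    (Q : Fin n → Matrix ι ι ℂ) : Prop :=
  (∀ j, (Q j).IsHermitian) ∧ ∀ i j, Commute (Q i) (Q j)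

/-- The trace norm, i.e. the sum of the singular values. -/
def traceNorm {ι : Type*} [Fintype ι] [DecidableEq ι] (A : Matrix ι ι ℂ) : ℝ :=
  ∑ i, Real.sqrt ((Matrix.isHermitian_conjTranspose_mul_self A).eigenvalues i)

/-- The Gibbs state `exp (-∑ j, lam j * Q j) / tr (exp (-∑ j, lam j * Q j))` with
multipliers `lam`. -/
def gibbsState {ι : Type*} [Fintype ι] [DecidableEq ι] {n : ℕ}
    (lam : Fin n → ℝ) (Q : Fin n → Matrix ι ι ℂ) : Matrix ι ι ℂ :=
  (NormedSpace.exp (-∑ j, (lam j : ℂ) • Q j)).trace⁻¹ •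
    NormedSpace.exp (-∑ j, (lam j : ℂ) • Q j)

/-- The microstates compatible with the macrostate `(v, Q)`. -/
def compatibleStates {ι : Type*} [Fintype ι] {n : ℕ}
    (v : Fin n → ℝ) (Q : Fin n → Matrix ι ι ℂ) : Set (Matrix ι ι ℂ) :=
  {ρ | IsDensityMatrix ρ ∧ ∀ j, (ρ * Q j).trace = (v j : ℂ)}

/-- `γ` is the generalised Gibbs ensemble of the macrostate `(v, Q)`: it has the expectation
values `v` and is a Gibbs state of `Q` or a limit of such states. The limits are the ensembles with
infinite multipliers; they are needed only for extremal `v` (for example, the ground-state energy),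
where no finite multipliers reproduce `v`. -/
def IsGeneralisedGibbsEnsemble {ι : Type*} [Fintype ι] [DecidableEq ι] {n : ℕ}
    (v : Fin n → ℝ) (Q : Fin n → Matrix ι ι ℂ) (γ : Matrix ι ι ℂ) : Prop :=
  γ ∈ closure (Set.range fun lam : Fin n → ℝ => gibbsState lam Q) ∧
    ∀ j, (γ * Q j).trace = (v j : ℂ)

/-- The tensor product of a finite family of matrices. -/
def tensorFamily {N : ℕ} {κ : Fin N → Type} (A : ∀ l, Matrix (κ l) (κ l) ℂ) :
    Matrix (∀ l, κ l) (∀ l, κ l) ℂ :=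
  Matrix.of fun a b => ∏ l, A l (a l) (b l)

/-- The partial trace over the second factor. -/
def partialTraceRight {ι κ : Type*} [Fintype κ] (M : Matrix (ι × κ) (ι × κ) ℂ) :
    Matrix ι ι ℂ :=
  Matrix.of fun i i' => ∑ a, M (i, a) (i', a)

/-- An environment for `n` charges: finitely many finite-dimensional systems, each with `n`
commuting observables. -/
structure ChargedEnvironment (n : ℕ) where
  /-- the number of systems -/
  N : ℕ
  /-- the Hilbert space dimensions -/
  dim : Fin N → ℕ
  dim_pos : ∀ l, 0 < dim l
  /-- the charges of each system -/
  charge : ∀ l, Fin n → Matrix (Fin (dim l)) (Fin (dim l)) ℂ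
  charge_comm : ∀ l, IsCommutingObservables (charge l)

namespace ChargedEnvironment

variable {n : ℕ} (E : ChargedEnvironment n)

/-- The index set of the product basis of the environment. -/
abbrev Index : Type := ∀ l, Fin (E.dim l)

/-- The total `j`-th charge of the environment, the sum over `l` of
`1 ⊗ ⋯ ⊗ E.charge l j ⊗ ⋯ ⊗ 1`. -/
def totalCharge (j : Fin n) : Matrix E.Index E.Index ℂ :=
  ∑ l, tensorFamily (Function.update
    (fun m => (1 : Matrix (Fin (E.dim m)) (Fin (E.dim m)) ℂ)) l (E.charge l j))

/-- The expectation values of the charges of the `l`-th system in its Gibbs state with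
parameters `β`. -/
def thermalValue (β : Fin n → ℝ) (l : Fin E.N) (j : Fin n) : ℝ :=
  (gibbsState β (E.charge l) * E.charge l j).trace.re

/-- The total `j`-th charge of the compound of a system with charges `Q` and the environment. -/
def compoundCharge {ι : Type*} [DecidableEq ι] (Q : Fin n → Matrix ι ι ℂ) (j : Fin n) :
    Matrix (ι × E.Index) (ι × E.Index) ℂ :=
  Q j ⊗ₖ (1 : Matrix E.Index E.Index ℂ) + (1 : Matrix ι ι ℂ) ⊗ₖ E.totalCharge j

/-- From the initial state `ρ ⊗ (⨂ l, σ l)` of the compound, the unitary `U` produces `ρf` on the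
system up to `ε` in trace norm, and changes the mean value of each total charge by at most `ε'`. -/
def Implements {ι : Type*} [Fintype ι] [DecidableEq ι] (Q : Fin n → Matrix ι ι ℂ)
    (U : Matrix (ι × E.Index) (ι × E.Index) ℂ) (ρf : Matrix ι ι ℂ) (ε ε' : ℝ)
    (ρ : Matrix ι ι ℂ) (σ : ∀ l, Matrix (Fin (E.dim l)) (Fin (E.dim l)) ℂ) : Prop :=
  traceNorm (partialTraceRight (U * (ρ ⊗ₖ tensorFamily σ) * Uᴴ) - ρf) ≤ ε ∧
  ∀ j, ‖(U * (ρ ⊗ₖ tensorFamily σ) * Uᴴ * E.compoundCharge Q j).trace -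
    ((ρ ⊗ₖ tensorFamily σ) * E.compoundCharge Q j).trace‖ ≤ ε'

end ChargedEnvironment

/-- `ρf` can be reached from the macrostate `(v, Q)` by macrostate operations: one environment and
one unitary work for all microstates of system and environment that are compatible with the
given expectation values. -/
def MacroReachable {ι : Type*} [Fintype ι] [DecidableEq ι] {n : ℕ} (β : Fin n → ℝ)
    (v : Fin n → ℝ) (Q : Fin n → Matrix ι ι ℂ) (ρf : Matrix ι ι ℂ) : Prop :=
  ∀ ε > 0, ∀ ε' > 0, ∃ E : ChargedEnvironment n,
    ∃ U ∈ Matrix.unitaryGroup (ι × E.Index) ℂ,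
      ∀ ρ ∈ compatibleStates v Q,
      ∀ σ : ∀ l, Matrix (Fin (E.dim l)) (Fin (E.dim l)) ℂ,
        (∀ l, σ l ∈ compatibleStates (E.thermalValue β l) (E.charge l)) →
        E.Implements Q U ρf ε ε' ρ σ

/-- `ρf` can be reached from the microstate `ρ` by microstate operations: every system of the
environment is in its Gibbs state with parameters `β`. -/
def MicroReachable {ι : Type*} [Fintype ι] [DecidableEq ι] {n : ℕ} (β : Fin n → ℝ)
    (Q : Fin n → Matrix ι ι ℂ) (ρ ρf : Matrix ι ι ℂ) : Prop :=
  ∀ ε > 0, ∀ ε' > 0, ∃ E : ChargedEnvironment n,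
    ∃ U ∈ Matrix.unitaryGroup (ι × E.Index) ℂ,
      E.Implements Q U ρf ε ε' ρ (fun l => gibbsState β (E.charge l))

/-- The macrostate `(v, Q)` and the microstate `ρ` are operationally equivalent: they allow the
same transitions. -/
def OperationallyEquivalent {ι : Type*} [Fintype ι] [DecidableEq ι] {n : ℕ} (β : Fin n → ℝ)
    (v : Fin n → ℝ) (Q : Fin n → Matrix ι ι ℂ) (ρ : Matrix ι ι ℂ) : Prop :=
  ∀ ρf : Matrix ι ι ℂ, IsDensityMatrix ρf →
    (MacroReachable β v Q ρf ↔ MicroReachable β Q ρ ρf)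

end

/-! Macrostate to microstate is immediate: the GGE and the thermal environment states are among the
states compatible with the prescribed mean values.

For the converse, let `U` and `E` implement the transition from `τ = γ ⊗ γ_β ⊗ ⋯ ⊗ γ_β`. Before `U`
is applied, every compatible state `ω` of `SE` is driven close to `τ` with the help of fresh thermal
qubits. A qubit with charge gap `x ≠ 0` has its excited population fixed by its macrostate, and the
gates used depend on nothing else. Resonant swaps equilibrate pairs of levels and random sign flips
remove coherences (`QubitAchievable.thermalisation`).

The swaps are resonant with respect to charges whose Gibbs distribution at `β` is `τ`. Since `γ` has
its own multipliers `μ`, these are not the physical charges but `Θ^j = (μ^j/β^j) Q^j + Q^j_E`; this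
is where `β^j ≠ 0` enters (`exists_rescaledCharges`). Thermalisation thus conserves `Θ` plus the
qubit charges, so the qubits absorb `tr((ω - ω₁)Θ^j)`, where `ω₁` is the thermalised state. This is
small although `ω` may be far from `τ`: `ω` and `τ` have the same mean of every `Q^j` and `Q^j_E`,
hence of `Θ^j`, and `ω₁ ≈ τ`. The physical balance is therefore almost that of `U` on `τ`
(`trace_charge_change`).

Two obstacles remain. If `γ` is only a limit of Gibbs states it may have zero populations; it is
still Gibbs on its support, and every compatible state lives on that support
(`exists_multiplier_of_tendsto_gibbsWeight`). If levels have equal rescaled charges, the swap qubit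
would have zero gap and an uncontrolled population; a small perturbation of `Θ` makes all gaps
nonzero at arbitrarily small cost. -/

noncomputable section

/-! ### Continuity of the trace norm -/

section TraceNorm

variable {ι : Type*} [Fintype ι] [DecidableEq ι]

theorem traceNorm_eq_trace_cfc (A : Matrix ι ι ℂ) :
    (traceNorm A : ℂ) = (cfc Real.sqrt (Aᴴ * A)).trace := by
  rw [(Matrix.isHermitian_conjTranspose_mul_self A).cfc_eq, Matrix.IsHermitian.cfc,
    Unitary.conjStarAlgAut_apply, Matrix.trace_mul_comm, ← mul_assoc]
  simp [traceNorm, Matrix.trace_diagonal]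

-- The trace norm is the trace of `√(Aᴴ A)`, so continuity of the functional calculus replaces any
-- tracking of individual singular values.
open scoped Matrix.Norms.L2Operator in
theorem continuous_traceNorm : Continuous (traceNorm : Matrix ι ι ℂ → ℝ) := by
  have h : Continuous fun A : Matrix ι ι ℂ => cfc Real.sqrt (Aᴴ * A) :=
    Continuous.cfc_of_mem_nhdsSet (s := Set.univ) Real.sqrt Filter.univ_mem
      (by fun_prop) (fun A => Matrix.isHermitian_conjTranspose_mul_self A)
      Real.continuous_sqrt.continuousOn
  have h2 : Continuous fun A : Matrix ι ι ℂ => (traceNorm A : ℂ) := by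
    simp_rw [traceNorm_eq_trace_cfc]
    exact h.matrix_trace
  exact Complex.continuous_re.comp h2

end TraceNorm

/-! ### Joint diagonalisation -/

section Diagonalisation

variable {ι : Type*} [Fintype ι] [DecidableEq ι] {n : ℕ}

theorem IsCommutingObservables.exists_orthonormalBasis {Q : Fin n → Matrix ι ι ℂ}
    (hQ : IsCommutingObservables Q) :
    ∃ (b : OrthonormalBasis ι ℂ (EuclideanSpace ℂ ι)) (q : ι → Fin n → ℂ),
      ∀ i j, Matrix.toEuclideanLin (Q j) (b i) = q i j • b i := by
  classical
  set T : Fin n → Module.End ℂ (EuclideanSpace ℂ ι) := fun j => Matrix.toEuclideanLin (Q j)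
  have hT : ∀ j, (T j).IsSymmetric := fun j =>
    Matrix.isSymmetric_toEuclideanLin_iff.2 (hQ.1 j)
  have hC : Pairwise (Function.onFun Commute T) := by
    intro i j _
    change Matrix.toEuclideanLin (Q i) * Matrix.toEuclideanLin (Q j) =
      Matrix.toEuclideanLin (Q j) * Matrix.toEuclideanLin (Q i)
    ext x : 1
    have h := congrArg (fun M : Matrix ι ι ℂ => Matrix.toEuclideanLin M x) (hQ.2 i j).eq
    simpa [Matrix.toLpLin_apply] using h
  have hI := LinearMap.IsSymmetric.directSum_isInternal_of_pairwise_commute hT hC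
  have hO := LinearMap.IsSymmetric.orthogonalFamily_iInf_eigenspaces hT
  set A : (Fin n → ℂ) → Submodule ℂ (EuclideanSpace ℂ ι) :=
    fun χ => ⨅ j, Module.End.eigenspace (T j) (χ j)
  -- The joint eigenspaces are indexed by all of `Fin n → ℂ`; restricting to the nonzero ones gives
  -- the finite index type from which a basis can be assembled.
  have hfin : {χ | A χ ≠ ⊥}.Finite :=
    WellFoundedGT.finite_ne_bot_of_iSupIndep hI.submodule_iSupIndep
  have : Fintype {χ // A χ ≠ ⊥} := hfin.fintype
  have hI' : DirectSum.IsInternal fun χ : {χ // A χ ≠ ⊥} => A χ :=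
    DirectSum.isInternal_ne_bot_iff.2 hI
  have hO' : OrthogonalFamily ℂ (fun χ : {χ // A χ ≠ ⊥} => A χ) fun χ => (A χ).subtypeₗᵢ :=
    hO.comp Subtype.val_injective
  have hd : Module.finrank ℂ (EuclideanSpace ℂ ι) = Fintype.card ι := finrank_euclideanSpace
  refine ⟨(hI'.subordinateOrthonormalBasis hd hO').reindex (Fintype.equivFin ι).symm,
    fun i => (hI'.subordinateOrthonormalBasisIndex hd (Fintype.equivFin ι i) hO').1, ?_⟩
  intro i j
  have h := hI'.subordinateOrthonormalBasis_subordinate hd (Fintype.equivFin ι i) hO'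
  simpa using Module.End.mem_eigenspace_iff.1 ((Submodule.mem_iInf _).1 h j)

/-- The columns of `V` are a joint eigenbasis. From here on commuting charges are treated as real
vectors `q i` attached to levels `i`. -/
theorem IsCommutingObservables.exists_diagonal {Q : Fin n → Matrix ι ι ℂ}
    (hQ : IsCommutingObservables Q) :
    ∃ V ∈ Matrix.unitaryGroup ι ℂ, ∃ q : ι → Fin n → ℝ,
      ∀ j, Q j = V * Matrix.diagonal (fun i => (q i j : ℂ)) * Vᴴ := by
  obtain ⟨b, q, hb⟩ := hQ.exists_orthonormalBasis
  set V : Matrix ι ι ℂ := (EuclideanSpace.basisFun ι ℂ).toBasis.toMatrix b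
  have hV : V ∈ Matrix.unitaryGroup ι ℂ :=
    OrthonormalBasis.toMatrix_orthonormalBasis_mem_unitary _ _
  have hVV : V * Vᴴ = 1 := (Matrix.mem_unitaryGroup_iff).1 hV
  have hq : ∀ i j, ((q i j).re : ℂ) = q i j := by
    intro i j
    refine Complex.conj_eq_iff_re.1 ?_
    refine (Matrix.isSymmetric_toEuclideanLin_iff.2 (hQ.1 j)).conj_eigenvalue_eq_self
      (Module.End.hasEigenvalue_of_hasEigenvector ⟨Module.End.mem_eigenspace_iff.2 (hb i j), ?_⟩)
    exact b.orthonormal.ne_zero i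
  refine ⟨V, hV, fun i j => (q i j).re, fun j => ?_⟩
  have h : Q j * V = V * Matrix.diagonal (fun i => q i j) := by
    ext a i
    have := congrArg (fun x : EuclideanSpace ℂ ι => x a) (hb i j)
    rw [Matrix.mul_diagonal, Matrix.mul_apply]
    simpa [Matrix.toLpLin_apply, Matrix.mulVec, dotProduct, V, Module.Basis.toMatrix_apply,
      mul_comm] using this
  simp_rw [hq]
  rw [← h, mul_assoc, hVV, mul_one]

theorem gibbsState_of_diagonal {Q : Fin n → Matrix ι ι ℂ} {V : Matrix ι ι ℂ}
    (hV : V ∈ Matrix.unitaryGroup ι ℂ) {q : ι → Fin n → ℝ}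
    (hq : ∀ j, Q j = V * Matrix.diagonal (fun i => (q i j : ℂ)) * Vᴴ) (lam : Fin n → ℝ) :
    gibbsState lam Q = V * Matrix.diagonal (fun i =>
      ((Real.exp (-(lam ⬝ᵥ q i)) / ∑ k, Real.exp (-(lam ⬝ᵥ q k)) : ℝ) : ℂ)) * Vᴴ := by
  have hVV : V * Vᴴ = 1 := (Matrix.mem_unitaryGroup_iff).1 hV
  have hVV' : Vᴴ * V = 1 := (Matrix.mem_unitaryGroup_iff').1 hV
  have hinv : V⁻¹ = Vᴴ := Matrix.inv_eq_right_inv hVV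
  have hexp : NormedSpace.exp (-∑ j, (lam j : ℂ) • Q j) =
      V * Matrix.diagonal (fun i => (Real.exp (-(lam ⬝ᵥ q i)) : ℂ)) * Vᴴ := by
    have h1 : -∑ j, (lam j : ℂ) • Q j =
        V * Matrix.diagonal (fun i => ((-(lam ⬝ᵥ q i) : ℝ) : ℂ)) * V⁻¹ := by
      have h2 : Matrix.diagonal (fun i => ((-(lam ⬝ᵥ q i) : ℝ) : ℂ)) =
          -∑ j, (lam j : ℂ) • Matrix.diagonal (fun i => (q i j : ℂ)) := by
        ext a b
        by_cases hab : a = b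
        · subst hab
          simp [Matrix.sum_apply, dotProduct]
        · simp [Matrix.sum_apply, hab]
      rw [h2, hinv]
      simp only [hq, mul_neg, neg_mul, Finset.mul_sum, Finset.sum_mul, Matrix.mul_smul,
        Matrix.smul_mul]
    rw [h1, Matrix.exp_conj _ _ ⟨⟨V, Vᴴ, hVV, hVV'⟩, rfl⟩, hinv, Matrix.exp_diagonal]
    congr 3
    funext i
    simp [← Complex.exp_eq_exp_ℂ]
  rw [gibbsState, hexp, Matrix.trace_mul_comm, ← mul_assoc, hVV', one_mul, Matrix.trace_diagonal,
    ← Matrix.smul_mul, ← Matrix.mul_smul, ← Matrix.diagonal_smul]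
  congr 3
  funext i
  simp [div_eq_inv_mul]

end Diagonalisation

/-! ### Tensor products of finite families -/

section TensorPi

variable {L : Type*} [Fintype L] {κ : L → Type*}

/-- The tensor product of a family of matrices indexed by a finite type. -/
def tensorPi (A : ∀ l, Matrix (κ l) (κ l) ℂ) : Matrix (∀ l, κ l) (∀ l, κ l) ℂ :=
  Matrix.of fun a b => ∏ l, A l (a l) (b l)

theorem tensorPi_apply (A : ∀ l, Matrix (κ l) (κ l) ℂ) (a b : ∀ l, κ l) :
    tensorPi A a b = ∏ l, A l (a l) (b l) := rfl

theorem tensorPi_conjTranspose (A : ∀ l, Matrix (κ l) (κ l) ℂ) :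
    (tensorPi A)ᴴ = tensorPi fun l => (A l)ᴴ := by
  ext a b
  simp [tensorPi_apply, Matrix.conjTranspose_apply]

theorem tensorPi_diagonal [∀ l, DecidableEq (κ l)] (d : ∀ l, κ l → ℂ) :
    tensorPi (fun l => Matrix.diagonal (d l)) = Matrix.diagonal fun a => ∏ l, d l (a l) := by
  ext a b
  rw [tensorPi_apply]
  by_cases hab : a = b
  · subst hab
    simp
  · obtain ⟨l, hl⟩ := Function.ne_iff.1 hab
    rw [Matrix.diagonal_apply_ne _ hab]
    exact Finset.prod_eq_zero (Finset.mem_univ l) (Matrix.diagonal_apply_ne _ hl)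

theorem tensorPi_one [∀ l, DecidableEq (κ l)] : tensorPi (fun l => (1 : Matrix (κ l) (κ l) ℂ)) = 1 := by
  simpa using tensorPi_diagonal (κ := κ) (fun _ _ => 1)

variable [DecidableEq L] [∀ l, Fintype (κ l)]

theorem tensorPi_mul (A B : ∀ l, Matrix (κ l) (κ l) ℂ) :
    tensorPi A * tensorPi B = tensorPi fun l => A l * B l := by
  ext a b
  simp only [tensorPi_apply, Matrix.mul_apply, Finset.prod_univ_sum, Fintype.piFinset_univ,
    Finset.prod_mul_distrib]

theorem trace_tensorPi (A : ∀ l, Matrix (κ l) (κ l) ℂ) :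
    (tensorPi A).trace = ∏ l, (A l).trace := by
  simp only [Matrix.trace, Matrix.diag, tensorPi_apply, Finset.prod_univ_sum,
    Fintype.piFinset_univ]

open scoped MatrixOrder in
theorem tensorPi_posSemidef {A : ∀ l, Matrix (κ l) (κ l) ℂ} (hA : ∀ l, (A l).PosSemidef) :
    (tensorPi A).PosSemidef := by
  classical
  have h : ∀ l, ∃ B, A l = Bᴴ * B := fun l =>
    CStarAlgebra.nonneg_iff_eq_star_mul_self.1 (Matrix.nonneg_iff_posSemidef.2 (hA l))
  choose B hB using h
  have : A = fun l => (B l)ᴴ * B l := funext hB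
  rw [this, ← tensorPi_mul, ← tensorPi_conjTranspose]
  exact Matrix.posSemidef_conjTranspose_mul_self _

theorem IsDensityMatrix.tensorPi {A : ∀ l, Matrix (κ l) (κ l) ℂ}
    (hA : ∀ l, IsDensityMatrix (A l)) : IsDensityMatrix (tensorPi A) :=
  ⟨tensorPi_posSemidef fun l => (hA l).1, by simp [trace_tensorPi, fun l => (hA l).2]⟩

variable [∀ l, DecidableEq (κ l)]

theorem tensorPi_mem_unitaryGroup {V : ∀ l, Matrix (κ l) (κ l) ℂ}
    (hV : ∀ l, V l ∈ Matrix.unitaryGroup (κ l) ℂ) :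
    tensorPi V ∈ Matrix.unitaryGroup (∀ l, κ l) ℂ := by
  rw [Matrix.mem_unitaryGroup_iff, Matrix.star_eq_conjTranspose, tensorPi_conjTranspose,
    tensorPi_mul]
  have : ∀ l, V l * (V l)ᴴ = 1 := fun l => Matrix.mem_unitaryGroup_iff.1 (hV l)
  simp_rw [this]
  exact tensorPi_one

end TensorPi

/-! ### Partial traces and density matrices -/

section PartialTrace

variable {X Y A : Type*} [Fintype A]

theorem partialTraceRight_apply (M : Matrix (X × A) (X × A) ℂ) (x y : X) :
    partialTraceRight M x y = ∑ a, M (x, a) (y, a) := rfl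

theorem partialTraceRight_kronecker (ω : Matrix X X ℂ) (σ : Matrix A A ℂ) :
    partialTraceRight (ω ⊗ₖ σ) = σ.trace • ω := by
  ext x y
  simp [partialTraceRight_apply, Matrix.trace, mul_comm, Finset.mul_sum]

theorem continuous_partialTraceRight :
    Continuous (partialTraceRight : Matrix (X × A) (X × A) ℂ → Matrix X X ℂ) :=
  continuous_matrix fun x y => by
    simp only [partialTraceRight_apply]
    exact continuous_finsetSum _ fun a _ => continuous_id.matrix_elem _ _

theorem partialTraceRight_posSemidef {M : Matrix (X × A) (X × A) ℂ} (hM : M.PosSemidef) :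
    (partialTraceRight M).PosSemidef := by
  have : partialTraceRight M = ∑ a, M.submatrix (fun x => (x, a)) fun x => (x, a) := by
    ext x y
    simp [partialTraceRight_apply, Matrix.sum_apply]
  rw [this]
  exact Matrix.posSemidef_sum _ fun a _ => hM.submatrix _

variable [Fintype X] [Fintype Y]

theorem trace_partialTraceRight (M : Matrix (X × A) (X × A) ℂ) :
    (partialTraceRight M).trace = M.trace := by
  simp [Matrix.trace, partialTraceRight_apply, Fintype.sum_prod_type]

theorem partialTraceRight_kronecker_one_mul [DecidableEq A] (C : Matrix X X ℂ)
    (M : Matrix (X × A) (X × A) ℂ) :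
    partialTraceRight ((C ⊗ₖ (1 : Matrix A A ℂ)) * M) = C * partialTraceRight M := by
  ext x y
  simp only [partialTraceRight_apply, Matrix.mul_apply, Fintype.sum_prod_type, Matrix.kronecker_apply,
    Matrix.one_apply, mul_ite, mul_one, mul_zero, ite_mul, zero_mul, Finset.sum_ite_eq,
    Finset.mem_univ, if_true, Finset.mul_sum]
  exact Finset.sum_comm

theorem partialTraceRight_mul_kronecker_one [DecidableEq A] (C : Matrix X X ℂ)
    (M : Matrix (X × A) (X × A) ℂ) :
    partialTraceRight (M * (C ⊗ₖ (1 : Matrix A A ℂ))) = partialTraceRight M * C := by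
  ext x y
  simp only [partialTraceRight_apply, Matrix.mul_apply, Fintype.sum_prod_type, Matrix.kronecker_apply,
    Matrix.one_apply, mul_ite, mul_one, mul_zero, Finset.sum_ite_eq',
    Finset.mem_univ, if_true, Finset.sum_mul]
  exact Finset.sum_comm

theorem trace_mul_kronecker_one [DecidableEq A] (M : Matrix (X × A) (X × A) ℂ)
    (C : Matrix X X ℂ) :
    (M * (C ⊗ₖ (1 : Matrix A A ℂ))).trace = (partialTraceRight M * C).trace := by
  rw [← trace_partialTraceRight, partialTraceRight_mul_kronecker_one]

theorem IsDensityMatrix.partialTraceRight {M : Matrix (X × A) (X × A) ℂ}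
    (hM : IsDensityMatrix M) : IsDensityMatrix (partialTraceRight M) :=
  ⟨partialTraceRight_posSemidef hM.1, by rw [trace_partialTraceRight, hM.2]⟩

theorem IsDensityMatrix.conj [DecidableEq X] {ρ V : Matrix X X ℂ} (hρ : IsDensityMatrix ρ)
    (hV : V ∈ Matrix.unitaryGroup X ℂ) : IsDensityMatrix (V * ρ * Vᴴ) := by
  refine ⟨hρ.1.mul_mul_conjTranspose_same V, ?_⟩
  rw [Matrix.trace_mul_comm, ← mul_assoc, show Vᴴ * V = 1 from Matrix.mem_unitaryGroup_iff'.1 hV,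
    one_mul, hρ.2]

theorem IsDensityMatrix.kronecker {ρ : Matrix X X ℂ} {σ : Matrix A A ℂ}
    (hρ : IsDensityMatrix ρ) (hσ : IsDensityMatrix σ) : IsDensityMatrix (ρ ⊗ₖ σ) :=
  ⟨hρ.1.kronecker hσ.1, by rw [Matrix.trace_kronecker, hρ.2, hσ.2, one_mul]⟩

theorem IsDensityMatrix.apply_self_eq {ρ : Matrix X X ℂ} (hρ : IsDensityMatrix ρ) (x : X) :
    ρ x x = ((ρ x x).re : ℂ) :=
  (Complex.conj_eq_iff_re.1 (hρ.1.1.apply x x)).symm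

theorem IsDensityMatrix.re_apply_nonneg {ρ : Matrix X X ℂ} (hρ : IsDensityMatrix ρ) (x : X) :
    0 ≤ (ρ x x).re := by
  classical
  exact (Complex.le_def.1 (hρ.1.diag_nonneg (i := x))).1

theorem IsDensityMatrix.sum_re_apply {ρ : Matrix X X ℂ} (hρ : IsDensityMatrix ρ) :
    ∑ x, (ρ x x).re = 1 := by
  have := congrArg Complex.re hρ.2
  simpa [Matrix.trace] using this

theorem IsDensityMatrix.re_apply_le_one {ρ : Matrix X X ℂ} (hρ : IsDensityMatrix ρ) (x : X) :
    (ρ x x).re ≤ 1 := by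
  rw [← hρ.sum_re_apply]
  exact Finset.single_le_sum (f := fun x => (ρ x x).re) (fun y _ => hρ.re_apply_nonneg y)
    (Finset.mem_univ x)

/-- Nonnegativity of the 2 × 2 principal minor gives `|ρ x y|² ≤ ρ x x * ρ y y`. -/
theorem IsDensityMatrix.norm_apply_le_one {ρ : Matrix X X ℂ} (hρ : IsDensityMatrix ρ)
    (x y : X) : ‖ρ x y‖ ≤ 1 := by
  have h := (hρ.1.submatrix ![x, y]).det_nonneg
  rw [Matrix.det_fin_two] at h
  simp only [Matrix.submatrix_apply, Matrix.cons_val_zero, Matrix.cons_val_one] at h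
  have h2 : ρ y x = star (ρ x y) := (hρ.1.1.apply y x).symm
  rw [h2, hρ.apply_self_eq x, hρ.apply_self_eq y, Complex.star_def, Complex.mul_conj,
    ← Complex.ofReal_mul, ← Complex.ofReal_sub, Complex.zero_le_real, sub_nonneg,
    Complex.normSq_eq_norm_sq] at h
  have h3 := mul_le_one₀ (hρ.re_apply_le_one x) (hρ.re_apply_nonneg y) (hρ.re_apply_le_one y)
  nlinarith [norm_nonneg (ρ x y)]

theorem conj_submatrix (e : X ≃ Y) (W M : Matrix Y Y ℂ) :
    W.submatrix e e * M.submatrix e e * (W.submatrix e e)ᴴ = (W * M * Wᴴ).submatrix e e := by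
  rw [Matrix.conjTranspose_submatrix, Matrix.submatrix_mul_equiv, Matrix.submatrix_mul_equiv]

theorem submatrix_mem_unitaryGroup [DecidableEq X] [DecidableEq Y] (e : X ≃ Y)
    {W : Matrix Y Y ℂ} (hW : W ∈ Matrix.unitaryGroup Y ℂ) :
    W.submatrix e e ∈ Matrix.unitaryGroup X ℂ := by
  rw [Matrix.mem_unitaryGroup_iff, Matrix.star_eq_conjTranspose, Matrix.conjTranspose_submatrix,
    Matrix.submatrix_mul_equiv, show W * Wᴴ = 1 from Matrix.mem_unitaryGroup_iff.1 hW,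
    Matrix.submatrix_one_equiv]

theorem kronecker_one_mem_unitaryGroup [DecidableEq X] [DecidableEq A]
    {W : Matrix X X ℂ} (hW : W ∈ Matrix.unitaryGroup X ℂ) :
    W ⊗ₖ (1 : Matrix A A ℂ) ∈ Matrix.unitaryGroup (X × A) ℂ :=
  Matrix.kronecker_mem_unitary hW (one_mem _)

theorem conj_kronecker_one [DecidableEq A] (W ω : Matrix X X ℂ) (σ : Matrix A A ℂ) :
    (W ⊗ₖ (1 : Matrix A A ℂ)) * (ω ⊗ₖ σ) * (W ⊗ₖ (1 : Matrix A A ℂ))ᴴ = (W * ω * Wᴴ) ⊗ₖ σ := by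
  simp [Matrix.conjTranspose_kronecker, ← Matrix.mul_kronecker_mul]

end PartialTrace

/-! ### Regrouping tensor factors and using two environments in succession. -/

section Split

variable {X A B C : Type*}

/-- Splits the second factor of a bipartite index set in two. -/
def splitEquiv (X : Type*) {A B C : Type*} (f : C ≃ A × B) : X × C ≃ (X × A) × B :=
  (Equiv.prodCongr (Equiv.refl X) f).trans (Equiv.prodAssoc X A B).symm

theorem splitEquiv_apply (f : C ≃ A × B) (p : X × C) :
    splitEquiv X f p = ((p.1, (f p.2).1), (f p.2).2) := rfl

variable [Fintype A] [Fintype B] [Fintype C]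

theorem partialTraceRight_submatrix_splitEquiv (f : C ≃ A × B)
    (M : Matrix ((X × A) × B) ((X × A) × B) ℂ) :
    partialTraceRight (M.submatrix (splitEquiv X f) (splitEquiv X f)) =
      partialTraceRight (partialTraceRight M) := by
  ext x y
  simp only [partialTraceRight_apply, Matrix.submatrix_apply, splitEquiv_apply]
  rw [← Fintype.sum_prod_type' (f := fun a b => M ((x, a), b) ((y, a), b))]
  exact Fintype.sum_equiv f _ _ fun c => rfl

variable [Fintype X]

theorem commute_submatrix (e : X ≃ A) {M N : Matrix A A ℂ} (h : Commute M N) :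
    Commute (M.submatrix e e) (N.submatrix e e) := by
  rw [commute_iff_eq, Matrix.submatrix_mul_equiv, Matrix.submatrix_mul_equiv, h.eq]

variable [DecidableEq X] [DecidableEq A] [DecidableEq B] [DecidableEq C]

theorem commute_kronecker_one {W D₁ : Matrix A A ℂ} (h : Commute W D₁) (D₂ : Matrix B B ℂ) :
    Commute (W ⊗ₖ (1 : Matrix B B ℂ)) (D₁ ⊗ₖ 1 + 1 ⊗ₖ D₂) := by
  refine Commute.add_right ?_ ?_
  · rw [commute_iff_eq, ← Matrix.mul_kronecker_mul, ← Matrix.mul_kronecker_mul, h.eq]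
  · rw [commute_iff_eq, ← Matrix.mul_kronecker_mul, ← Matrix.mul_kronecker_mul]
    simp

theorem commute_diagonal_splitEquiv (f : C ≃ A × B) {W : Matrix (X × A) (X × A) ℂ}
    {d₁ : X × A → ℂ} (h : Commute W (Matrix.diagonal d₁)) (d₂ : B → ℂ) {d : X × C → ℂ}
    (hd : ∀ p, d p = d₁ (p.1, (f p.2).1) + d₂ (f p.2).2) :
    Commute ((W ⊗ₖ (1 : Matrix B B ℂ)).submatrix (splitEquiv X f) (splitEquiv X f))
      (Matrix.diagonal d) := by
  have : Matrix.diagonal d = (Matrix.diagonal d₁ ⊗ₖ (1 : Matrix B B ℂ) +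
      (1 : Matrix (X × A) (X × A) ℂ) ⊗ₖ Matrix.diagonal d₂).submatrix
        (splitEquiv X f) (splitEquiv X f) := by
    have h1 : Matrix.diagonal d₁ ⊗ₖ (1 : Matrix B B ℂ) +
        (1 : Matrix (X × A) (X × A) ℂ) ⊗ₖ Matrix.diagonal d₂ =
        Matrix.diagonal fun p : (X × A) × B => d₁ p.1 + d₂ p.2 := by
      rw [← Matrix.diagonal_one, ← Matrix.diagonal_one, Matrix.diagonal_kronecker_diagonal,
        Matrix.diagonal_kronecker_diagonal, Matrix.diagonal_add]
      simp
    rw [h1, Matrix.submatrix_diagonal_equiv]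
    congr 1
    funext p
    exact hd p
  rw [this]
  exact commute_submatrix _ (commute_kronecker_one h _)

end Split

/-- `W₂` acts trivially on `A₁`, so `A₁` may be traced out before `W₂` is applied: the second
operation sees only the reduced state left by the first. -/
theorem partialTraceRight_sequential {X A₁ A₂ C : Type*} [Fintype X] [Fintype A₁] [Fintype A₂] [Fintype C]
    [DecidableEq A₁] [DecidableEq A₂] (f : C ≃ A₁ × A₂)
    (W₁ : Matrix (X × A₁) (X × A₁) ℂ) (W₂ : Matrix (X × A₂) (X × A₂) ℂ) (ω : Matrix X X ℂ)
    (σ₁ : Matrix A₁ A₁ ℂ) (σ₂ : Matrix A₂ A₂ ℂ) {Ω : Matrix (X × C) (X × C) ℂ}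
    (hΩ : Ω = ((ω ⊗ₖ σ₁) ⊗ₖ σ₂).submatrix (splitEquiv X f) (splitEquiv X f))
    {U : Matrix (X × C) (X × C) ℂ}
    (hU : U = (W₂ ⊗ₖ (1 : Matrix A₁ A₁ ℂ)).submatrix (splitEquiv X (f.trans (Equiv.prodComm _ _)))
        (splitEquiv X (f.trans (Equiv.prodComm _ _))) *
      (W₁ ⊗ₖ (1 : Matrix A₂ A₂ ℂ)).submatrix (splitEquiv X f) (splitEquiv X f)) :
    partialTraceRight (U * Ω * Uᴴ) =
      partialTraceRight (W₂ * (partialTraceRight (W₁ * (ω ⊗ₖ σ₁) * W₁ᴴ) ⊗ₖ σ₂) * W₂ᴴ) := by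
  set e₁ := splitEquiv X f
  set e₂ := splitEquiv X (f.trans (Equiv.prodComm _ _))
  set Y := W₁ * (ω ⊗ₖ σ₁) * W₁ᴴ
  -- `Z` is `Y ⊗ σ₂` with the factors `A₁` and `A₂` interchanged, so that `A₁` becomes the outer
  -- factor.
  set Z : Matrix ((X × A₂) × A₁) ((X × A₂) × A₁) ℂ :=
    Matrix.of fun p q => Y (p.1.1, p.2) (q.1.1, q.2) * σ₂ p.1.2 q.1.2
  have h1 : (Y ⊗ₖ σ₂).submatrix e₁ e₁ = Z.submatrix e₂ e₂ := by
    ext p q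
    simp [e₁, e₂, Z, splitEquiv_apply]
  have h2 : partialTraceRight Z = partialTraceRight Y ⊗ₖ σ₂ := by
    ext p q
    simp [partialTraceRight_apply, Z, Finset.sum_mul]
  have h3 : U * Ω * Uᴴ = ((W₂ ⊗ₖ (1 : Matrix A₁ A₁ ℂ)) * Z * (W₂ ⊗ₖ 1)ᴴ).submatrix e₂ e₂ := by
    rw [← conj_submatrix, ← h1, ← conj_kronecker_one, ← conj_submatrix, hU, hΩ,
      Matrix.conjTranspose_mul]
    simp only [mul_assoc]
  rw [h3, partialTraceRight_submatrix_splitEquiv, Matrix.conjTranspose_kronecker,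
    Matrix.conjTranspose_one, partialTraceRight_mul_kronecker_one,
    partialTraceRight_kronecker_one_mul, h2]

/-! ### Operations implemented with thermal qubits -/

section Qubits

variable {X : Type*} [Fintype X] [DecidableEq X] {n : ℕ}

/-- The thermal population of the excited level of a qubit with charge gap `x`. -/
def excitedPopulation (β x : Fin n → ℝ) : ℝ :=
  Real.exp (-(β ⬝ᵥ x)) / (1 + Real.exp (-(β ⬝ᵥ x)))

theorem excitedPopulation_pos (β x : Fin n → ℝ) : 0 < excitedPopulation β x := by
  unfold excitedPopulation
  positivity

theorem excitedPopulation_lt_one (β x : Fin n → ℝ) : excitedPopulation β x < 1 := by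
  unfold excitedPopulation
  rw [div_lt_one (by positivity)]
  linarith

/-- A qubit state whose excited level has population `w`. -/
def IsQubitState (w : ℝ) (σ : Matrix (Fin 2) (Fin 2) ℂ) : Prop :=
  IsDensityMatrix σ ∧ σ 1 1 = w

theorem IsQubitState.apply_zero_zero {w : ℝ} {σ : Matrix (Fin 2) (Fin 2) ℂ}
    (h : IsQubitState w σ) : σ 0 0 = 1 - w := by
  have := h.1.2
  rw [Matrix.trace_fin_two, h.2] at this
  exact eq_sub_of_add_eq this

/-- The total charge of the qubit configuration `a` when qubit `l` has charge gap `x l`. -/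
def qubitCharge {L : Type*} [Fintype L] (x : L → Fin n → ℝ) (a : L → Fin 2) (j : Fin n) : ℝ :=
  ∑ l, ((a l : ℕ) : ℝ) * x l j

/-- `W` conserves the charges `θ` of the system plus those of the qubits. -/
def ConservesCharges {L : Type*} [Fintype L] [DecidableEq L] (θ : X → Fin n → ℝ)
    (x : L → Fin n → ℝ) (W : Matrix (X × (L → Fin 2)) (X × (L → Fin 2)) ℂ) : Prop :=
  ∀ j, Commute W
    (Matrix.diagonal fun p => ((θ p.1 j : ℝ) : ℂ) + ((qubitCharge x p.2 j : ℝ) : ℂ))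

/-- The relation `R` between initial and final states of the system is guaranteed by some
charge-conserving unitary that couples the system to qubits with thermal populations. -/
def QubitAchievable (β : Fin n → ℝ) (θ : X → Fin n → ℝ)
    (R : Matrix X X ℂ → Matrix X X ℂ → Prop) : Prop :=
  ∃ (L : Type) (_ : Fintype L) (_ : DecidableEq L) (x : L → Fin n → ℝ), (∀ l, x l ≠ 0) ∧
    ∃ W ∈ Matrix.unitaryGroup (X × (L → Fin 2)) ℂ, ConservesCharges θ x W ∧
      ∀ ω, IsDensityMatrix ω → ∀ σ : L → Matrix (Fin 2) (Fin 2) ℂ,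
        (∀ l, IsQubitState (excitedPopulation β (x l)) (σ l)) →
          R ω (partialTraceRight (W * (ω ⊗ₖ tensorPi σ) * Wᴴ))

variable {β : Fin n → ℝ} {θ : X → Fin n → ℝ} {R R₁ R₂ : Matrix X X ℂ → Matrix X X ℂ → Prop}

theorem IsDensityMatrix.qubit_evolution {L : Type*} [Fintype L] [DecidableEq L]
    {W : Matrix (X × (L → Fin 2)) (X × (L → Fin 2)) ℂ}
    (hW : W ∈ Matrix.unitaryGroup (X × (L → Fin 2)) ℂ) {ω : Matrix X X ℂ}
    (hω : IsDensityMatrix ω) {σ : L → Matrix (Fin 2) (Fin 2) ℂ}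
    (hσ : ∀ l, IsDensityMatrix (σ l)) :
    IsDensityMatrix (W * (ω ⊗ₖ _root_.tensorPi σ) * Wᴴ) :=
  (hω.kronecker (IsDensityMatrix.tensorPi hσ)).conj hW

theorem QubitAchievable.mono (h : QubitAchievable β θ R₁)
    (hR : ∀ ω ω', IsDensityMatrix ω → IsDensityMatrix ω' → R₁ ω ω' → R₂ ω ω') :
    QubitAchievable β θ R₂ := by
  obtain ⟨L, i1, i2, x, hx, W, hW, hc, h⟩ := h
  exact ⟨L, i1, i2, x, hx, W, hW, hc, fun ω hω σ hσ => hR _ _ hω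
    (hω.qubit_evolution hW fun l => (hσ l).1).partialTraceRight (h ω hω σ hσ)⟩

theorem QubitAchievable.id : QubitAchievable β θ fun ω ω' => ω' = ω := by
  refine ⟨Empty, inferInstance, inferInstance, fun l => l.elim, fun l => l.elim, 1, one_mem _,
    fun j => Commute.one_left _, fun ω _ σ _ => ?_⟩
  rw [one_mul, Matrix.conjTranspose_one, mul_one, partialTraceRight_kronecker, trace_tensorPi]
  simp

/-- The second operation uses fresh qubits, uncorrelated with what the first one left behind; its
guarantee therefore applies to the intermediate reduced state. -/
theorem QubitAchievable.comp (h₁ : QubitAchievable β θ R₁) (h₂ : QubitAchievable β θ R₂) :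
    QubitAchievable β θ fun ω ω' => ∃ ω₁, IsDensityMatrix ω₁ ∧ R₁ ω ω₁ ∧ R₂ ω₁ ω' := by
  obtain ⟨L₁, _, _, x₁, hx₁, W₁, hW₁, hc₁, h₁⟩ := h₁
  obtain ⟨L₂, _, _, x₂, hx₂, W₂, hW₂, hc₂, h₂⟩ := h₂
  let f : (L₁ ⊕ L₂ → Fin 2) ≃ (L₁ → Fin 2) × (L₂ → Fin 2) :=
    Equiv.sumArrowEquivProdArrow L₁ L₂ (Fin 2)
  refine ⟨L₁ ⊕ L₂, inferInstance, inferInstance, Sum.elim x₁ x₂, ?_, _,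
    mul_mem (submatrix_mem_unitaryGroup (splitEquiv X (f.trans (Equiv.prodComm _ _)))
      (kronecker_one_mem_unitaryGroup hW₂))
      (submatrix_mem_unitaryGroup (splitEquiv X f) (kronecker_one_mem_unitaryGroup hW₁)), ?_, ?_⟩
  · rintro (l | l)
    · exact hx₁ l
    · exact hx₂ l
  · intro j
    refine Commute.mul_left ?_ ?_
    · refine commute_diagonal_splitEquiv _ (hc₂ j) (fun a => ((qubitCharge x₁ a j : ℝ) : ℂ)) ?_
      intro p
      simp [qubitCharge, f, Equiv.sumArrowEquivProdArrow]
      ring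
    · refine commute_diagonal_splitEquiv _ (hc₁ j) (fun a => ((qubitCharge x₂ a j : ℝ) : ℂ)) ?_
      intro p
      simp [qubitCharge, f, Equiv.sumArrowEquivProdArrow]
      ring
  · intro ω hω σ hσ
    have hd := hω.qubit_evolution hW₁ fun l => (hσ (Sum.inl l)).1
    refine ⟨_, hd.partialTraceRight, h₁ ω hω _ fun l => hσ (Sum.inl l), ?_⟩
    rw [partialTraceRight_sequential f W₁ W₂ ω (tensorPi fun l => σ (Sum.inl l))
      (tensorPi fun l => σ (Sum.inr l)) _ rfl]
    · exact h₂ _ hd.partialTraceRight _ fun l => hσ (Sum.inr l)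
    · ext p q
      simp [tensorPi_apply, splitEquiv_apply, f, Equiv.sumArrowEquivProdArrow, mul_assoc]

end Qubits

/-! ### Elementary gates with one thermal qubit. -/

section Gates

variable {X : Type*} [Fintype X] [DecidableEq X] {n : ℕ} {β : Fin n → ℝ} {θ : X → Fin n → ℝ}

theorem sum_unit_arrow_fin_two {M : Type*} [AddCommMonoid M] (f : (Unit → Fin 2) → M) :
    ∑ a, f a = f (fun _ => 0) + f (fun _ => 1) := by
  rw [Fintype.sum_equiv (Equiv.funUnique Unit (Fin 2)) f (fun i => f fun _ => i), Fin.sum_univ_two]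
  intro a
  congr 1

theorem conj_one_submatrix {Y : Type*} [Fintype Y] [DecidableEq Y] (π : Equiv.Perm Y)
    (M : Matrix Y Y ℂ) :
    (1 : Matrix Y Y ℂ).submatrix π id * M * ((1 : Matrix Y Y ℂ).submatrix π id)ᴴ =
      M.submatrix π π := by
  ext p q
  simp [Matrix.mul_apply, Matrix.one_apply]

/-- A resonant swap with one thermal qubit redistributes the population of the levels `h`, `k` in
the ratio of their Boltzmann weights. -/
theorem qubitAchievable_swap {h k : X} (hθ : θ h ≠ θ k) :
    QubitAchievable β θ fun ω ω' =>
      ω' h h = excitedPopulation β (θ h - θ k) * (ω h h + ω k k) ∧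
      ω' k k = (1 - excitedPopulation β (θ h - θ k)) * (ω h h + ω k k) ∧
      ∀ x, x ≠ h → x ≠ k → ω' x x = ω x x := by
  have hhk : h ≠ k := fun e => hθ (by rw [e])
  -- The two exchanged basis states have equal total charge because the qubit gap is `θ h - θ k`.
  set π : Equiv.Perm (X × (Unit → Fin 2)) := Equiv.swap (h, fun _ => 0) (k, fun _ => 1)
  have h01 : (fun _ : Unit => (0 : Fin 2)) ≠ fun _ => 1 := fun e => by
    simpa using congrFun e ()
  refine ⟨Unit, inferInstance, inferInstance, fun _ => θ h - θ k, fun _ => sub_ne_zero.2 hθ,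
    (1 : Matrix _ _ ℂ).submatrix π id, ?_, ?_, ?_⟩
  · have := conj_one_submatrix π 1
    rw [mul_one, Matrix.submatrix_one_equiv] at this
    exact Matrix.mem_unitaryGroup_iff.2 this
  · intro j
    set d : X × (Unit → Fin 2) → ℂ := fun p =>
      ((θ p.1 j : ℝ) : ℂ) + ((qubitCharge (fun _ : Unit => θ h - θ k) p.2 j : ℝ) : ℂ) with hd
    have hdπ : ∀ p, d (π p) = d p := by
      intro p
      have h0 : d (h, fun _ => 0) = d (k, fun _ => 1) := by
        simp [hd, qubitCharge]
      by_cases hp : p = (h, fun _ => 0)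
      · subst hp
        simp [π, h0]
      by_cases hp' : p = (k, fun _ => 1)
      · subst hp'
        simp [π, h0]
      · rw [show π p = p from Equiv.swap_apply_of_ne_of_ne hp hp']
    rw [commute_iff_eq]
    ext p q
    rw [Matrix.mul_diagonal, Matrix.diagonal_mul, Matrix.submatrix_apply, Matrix.one_apply]
    by_cases hpq : π p = q
    · subst hpq
      simp [hdπ]
    · simp [hpq]
  · intro ω _ σ hσ
    have e0 := (hσ ()).apply_zero_zero
    have e1 := (hσ ()).2
    -- Conjugation by a permutation maps diagonal entries to diagonal entries, so the unknown
    -- coherences of the qubit do not affect the new populations.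
    have key : ∀ x, partialTraceRight ((1 : Matrix _ _ ℂ).submatrix π id * (ω ⊗ₖ tensorPi σ) *
        ((1 : Matrix _ _ ℂ).submatrix π id)ᴴ) x x =
        (ω ⊗ₖ tensorPi σ) (π (x, fun _ => 0)) (π (x, fun _ => 0)) +
        (ω ⊗ₖ tensorPi σ) (π (x, fun _ => 1)) (π (x, fun _ => 1)) := by
      intro x
      rw [conj_one_submatrix, partialTraceRight_apply, sum_unit_arrow_fin_two]
      rfl
    refine ⟨?_, ?_, fun x hxh hxk => ?_⟩
    · have a1 : π (h, fun _ => 0) = (k, fun _ => 1) := Equiv.swap_apply_left _ _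
      have a2 : π (h, fun _ => 1) = (h, fun _ => 1) :=
        Equiv.swap_apply_of_ne_of_ne (fun e => h01 (Prod.ext_iff.1 e).2.symm)
          (fun e => hhk (Prod.ext_iff.1 e).1)
      rw [key, a1, a2]
      simp [tensorPi_apply, e1]
      ring
    · have a1 : π (k, fun _ => 1) = (h, fun _ => 0) := Equiv.swap_apply_right _ _
      have a2 : π (k, fun _ => 0) = (k, fun _ => 0) :=
        Equiv.swap_apply_of_ne_of_ne (fun e => hhk (Prod.ext_iff.1 e).1.symm)
          (fun e => h01 (Prod.ext_iff.1 e).2)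
      rw [key, a1, a2]
      simp [tensorPi_apply, e0]
      ring
    · have a : ∀ c, π (x, c) = (x, c) := fun c =>
        Equiv.swap_apply_of_ne_of_ne (fun e => hxh (Prod.ext_iff.1 e).1)
          (fun e => hxk (Prod.ext_iff.1 e).1)
      rw [key, a, a]
      simp [tensorPi_apply, e0, e1]
      ring

/-- A sign flip of the level `x₀` controlled by one thermal qubit. -/
theorem qubitAchievable_signFlip {y : Fin n → ℝ} (hy : y ≠ 0) (x₀ : X) :
    QubitAchievable β θ fun ω ω' => ∀ x x', ω' x x' = ω x x' *
      ((1 - excitedPopulation β y) + (if x = x₀ then -1 else 1) * (if x' = x₀ then -1 else 1) *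
        excitedPopulation β y) := by
  -- Being diagonal, the gate commutes with every charge, and after the qubit is traced out only its
  -- populations matter.
  set d : X × (Unit → Fin 2) → ℂ := fun p => if p.1 = x₀ ∧ p.2 () = 1 then -1 else 1 with hd
  have hstar : ∀ p, star (d p) = d p := by
    intro p
    simp only [hd]
    split_ifs <;> simp
  have hdd : ∀ p, d p * d p = 1 := by
    intro p
    simp only [hd]
    split_ifs <;> simp
  have hdH : (Matrix.diagonal d)ᴴ = Matrix.diagonal d := by
    rw [Matrix.diagonal_conjTranspose]
    congr 1
    exact funext hstar
  refine ⟨Unit, inferInstance, inferInstance, fun _ => y, fun _ => hy,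
    Matrix.diagonal d, ?_, ?_, ?_⟩
  · rw [Matrix.mem_unitaryGroup_iff, Matrix.star_eq_conjTranspose, hdH,
      Matrix.diagonal_mul_diagonal]
    simp [hdd]
  · intro j
    exact Matrix.commute_diagonal _ _
  · intro ω _ σ hσ x x'
    have e0 := (hσ ()).apply_zero_zero
    have e1 := (hσ ()).2
    rw [hdH, partialTraceRight_apply, sum_unit_arrow_fin_two]
    simp only [Matrix.mul_diagonal, Matrix.diagonal_mul, Matrix.kronecker_apply, tensorPi_apply, hd,
      Finset.univ_unique, Finset.prod_singleton, e0, e1]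
    by_cases hx : x = x₀ <;> by_cases hx' : x' = x₀ <;> simp [hx, hx'] <;> ring

end Gates

/-! ### Thermalisation -/

section Thermalisation

variable {X : Type*} {n : ℕ} {β : Fin n → ℝ} {θ : X → Fin n → ℝ}

/-- The populations of `ω` lie between `m` and `M` times the weights `g`. -/
def PopulationBounds (g : X → ℝ) (m M : ℝ) (ω : Matrix X X ℂ) : Prop :=
  ∀ x, m * g x ≤ (ω x x).re ∧ (ω x x).re ≤ M * g x

/-- `g` is a Gibbs distribution of the charges `θ` on its support. -/
def IsGibbsOnSupport (β : Fin n → ℝ) (θ : X → Fin n → ℝ) (g : X → ℝ) : Prop :=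
  ∃ c > 0, ∀ x, g x = 0 ∨ g x = c * Real.exp (-(β ⬝ᵥ θ x))

variable {g : X → ℝ}

theorem IsGibbsOnSupport.nonneg (hg : IsGibbsOnSupport β θ g) (x : X) : 0 ≤ g x := by
  obtain ⟨c, hc, h⟩ := hg
  rcases h x with h | h <;> rw [h]
  positivity

theorem IsGibbsOnSupport.excitedPopulation_eq (hg : IsGibbsOnSupport β θ g) {h k : X}
    (hh : 0 < g h) (hk : 0 < g k) : excitedPopulation β (θ h - θ k) = g h / (g h + g k) := by
  obtain ⟨c, hc, H⟩ := hg
  rw [(H h).resolve_left hh.ne', (H k).resolve_left hk.ne', excitedPopulation, dotProduct_sub,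
    neg_sub, sub_eq_neg_add, Real.exp_add, Real.exp_neg (β ⬝ᵥ θ k), Real.exp_neg (β ⬝ᵥ θ h)]
  have h1 := Real.exp_pos (β ⬝ᵥ θ h)
  have h2 := Real.exp_pos (β ⬝ᵥ θ k)
  field_simp
  ring

variable [Fintype X] [DecidableEq X]

/-- The hub `h` is swapped with each level of `S` in turn. A swap replaces the ratios `ω x x / g x`
of its two levels by their average with weights `w` and `1 - w`, so all ratios stay in `[m, M]` and
every level touched retains a share `A` of one common value `t`. -/
theorem QubitAchievable.hub_round (hg : IsGibbsOnSupport β θ g) (hθ : Function.Injective θ)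
    {h : X} (hh : 0 < g h) (S : Finset X) (hS : ∀ k ∈ S, 0 < g k ∧ k ≠ h) :
    ∃ A > 0, A ≤ 1 ∧ QubitAchievable β θ fun ω ω' => ∀ m M, PopulationBounds g m M ω →
      PopulationBounds g m M ω' ∧ ∃ t, m ≤ t ∧ t ≤ M ∧ ∀ x ∈ insert h S,
        (A * t + (1 - A) * m) * g x ≤ (ω' x x).re ∧
        (ω' x x).re ≤ (A * t + (1 - A) * M) * g x := by
  induction S using Finset.induction_on with
  | empty =>
    -- The common value `t` is the initial ratio at the hub.
    refine ⟨1, one_pos, le_rfl, QubitAchievable.id.mono ?_⟩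
    rintro _ ω - - rfl m M hb
    refine ⟨hb, (ω h h).re / g h, (le_div_iff₀ hh).2 (hb h).1, (div_le_iff₀ hh).2 (hb h).2, ?_⟩
    intro x hx
    obtain rfl : x = h := by simpa using hx
    have : (ω x x).re / g x * g x = (ω x x).re := div_mul_cancel₀ _ hh.ne'
    constructor <;> linarith
  | insert k S hkS ih =>
    obtain ⟨A, hA0, hA1, ih⟩ := ih fun k hk => hS k (Finset.mem_insert_of_mem hk)
    obtain ⟨hk, hkh⟩ := hS k (Finset.mem_insert_self _ _)
    set w := excitedPopulation β (θ h - θ k)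
    have hw0 : 0 < w := excitedPopulation_pos _ _
    have hw1 : w < 1 := excitedPopulation_lt_one _ _
    -- Detailed balance: the swap leaves the distribution `g` invariant on the pair.
    have hwg : w * g k = (1 - w) * g h := by
      have : w = g h / (g h + g k) := hg.excitedPopulation_eq hh hk
      rw [this]
      field_simp
      ring
    -- The hub contributes to the new average with weight `w`, so its share of `t` drops from `A` to
    -- `w * A`. Levels treated earlier hold the larger share `A`, which is more than enough since `m
    -- ≤ t ≤ M`.
    refine ⟨w * A, by positivity, mul_le_one₀ hw1.le hA0.le hA1,
      (ih.comp (qubitAchievable_swap (h := h) (k := k) fun e => hkh (hθ e).symm)).mono ?_⟩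
    rintro ω ω'' - - ⟨ω', -, h1, c1, c2, c3⟩ m M hb
    obtain ⟨hb', t, hmt, htM, ht⟩ := h1 m M hb
    have d1 : (ω'' h h).re = w * ((ω' h h).re + (ω' k k).re) := by
      rw [c1]
      simp [w]
    have d2 : (ω'' k k).re = (1 - w) * ((ω' h h).re + (ω' k k).re) := by
      rw [c2]
      have : (1 : ℂ) - ((w : ℝ) : ℂ) = ((1 - w : ℝ) : ℂ) := by push_cast; rfl
      rw [this, Complex.re_ofReal_mul, Complex.add_re]
    obtain ⟨p1, p2⟩ := ht h (Finset.mem_insert_self _ _)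
    obtain ⟨p3, p4⟩ := hb' k
    have hw1' : 0 < 1 - w := sub_pos.2 hw1
    have key : ∀ x ∈ insert h (insert k S),
        (w * A * t + (1 - w * A) * m) * g x ≤ (ω'' x x).re ∧
        (ω'' x x).re ≤ (w * A * t + (1 - w * A) * M) * g x := by
      intro x hx
      by_cases hxh : x = h
      · subst hxh
        rw [d1]
        constructor
        · calc (w * A * t + (1 - w * A) * m) * g x
              = w * ((A * t + (1 - A) * m) * g x) + (1 - w) * g x * m := by ring
            _ = w * ((A * t + (1 - A) * m) * g x + m * g k) := by rw [← hwg]; ring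
            _ ≤ _ := by gcongr
        · calc w * ((ω' x x).re + (ω' k k).re)
              ≤ w * ((A * t + (1 - A) * M) * g x + M * g k) := by gcongr
            _ = w * ((A * t + (1 - A) * M) * g x) + w * g k * M := by ring
            _ = _ := by rw [hwg]; ring
      by_cases hxk : x = k
      · subst hxk
        rw [d2]
        constructor
        · calc (w * A * t + (1 - w * A) * m) * g x
              = w * g x * (A * t + (1 - A) * m) + (1 - w) * (m * g x) := by ring
            _ = (1 - w) * ((A * t + (1 - A) * m) * g h + m * g x) := by rw [hwg]; ring
            _ ≤ _ := by gcongr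
        · calc (1 - w) * ((ω' h h).re + (ω' x x).re)
              ≤ (1 - w) * ((A * t + (1 - A) * M) * g h + M * g x) := by gcongr
            _ = (1 - w) * g h * (A * t + (1 - A) * M) + (1 - w) * (M * g x) := by ring
            _ = _ := by rw [← hwg]; ring
      have hxS : x ∈ insert h S := by
        simp only [Finset.mem_insert] at hx ⊢
        tauto
      rw [c3 x hxh hxk]
      obtain ⟨q1, q2⟩ := ht x hxS
      have hgx := hg.nonneg x
      have hA' : 0 ≤ (1 - w) * A := by positivity
      refine ⟨le_trans ?_ q1, q2.trans ?_⟩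
      · refine mul_le_mul_of_nonneg_right ?_ hgx
        nlinarith [mul_nonneg hA' (sub_nonneg.2 hmt)]
      · refine mul_le_mul_of_nonneg_right ?_ hgx
        nlinarith [mul_nonneg hA' (sub_nonneg.2 htM)]
    refine ⟨fun x => ?_, t, hmt, htM, key⟩
    by_cases hx : x ∈ insert h (insert k S)
    · obtain ⟨q1, q2⟩ := key x hx
      have hgx := hg.nonneg x
      have hwA : 0 ≤ w * A := by positivity
      refine ⟨le_trans ?_ q1, q2.trans ?_⟩
      · refine mul_le_mul_of_nonneg_right ?_ hgx
        nlinarith [mul_nonneg hwA (sub_nonneg.2 hmt)]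
      · refine mul_le_mul_of_nonneg_right ?_ hgx
        nlinarith [mul_nonneg hwA (sub_nonneg.2 htM)]
    · simp only [Finset.mem_insert, not_or] at hx
      rw [c3 x hx.1 hx.2.1]
      exact hb' x

/-- After one round through the whole support all ratios share the summand `A * t`; only the
remaining fraction `1 - A` of the spread survives. The factor depends on neither the state nor the
bounds, so rounds can be iterated. -/
theorem QubitAchievable.contraction (hg : IsGibbsOnSupport β θ g) (hθ : Function.Injective θ)
    (hg1 : ∑ x, g x = 1) :
    ∃ c, 0 ≤ c ∧ c < 1 ∧ QubitAchievable β θ fun ω ω' => ∀ m M, PopulationBounds g m M ω →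
      ∃ m' M', M' - m' ≤ c * (M - m) ∧ PopulationBounds g m' M' ω' := by
  obtain ⟨h, -, hh⟩ : ∃ h ∈ Finset.univ, g h ≠ 0 :=
    Finset.exists_ne_zero_of_sum_ne_zero (by rw [hg1]; exact one_ne_zero)
  have hh : 0 < g h := lt_of_le_of_ne (hg.nonneg h) hh.symm
  obtain ⟨A, hA0, hA1, H⟩ := QubitAchievable.hub_round hg hθ hh
    (Finset.univ.filter fun k => 0 < g k ∧ k ≠ h) (by simp)
  refine ⟨1 - A, by linarith, by linarith, H.mono ?_⟩
  intro ω ω' _ _ H m M hb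
  obtain ⟨hb', t, -, -, ht⟩ := H m M hb
  refine ⟨A * t + (1 - A) * m, A * t + (1 - A) * M, by linarith, fun x => ?_⟩
  by_cases hx : g x = 0
  -- Outside the support both bounds are zero, whatever `m` and `M` are.
  · simpa [hx] using hb' x
  · refine ht x ?_
    have := lt_of_le_of_ne (hg.nonneg x) (Ne.symm hx)
    by_cases hxh : x = h <;> simp [hxh, this]

/-- The spread `M - m` shrinks geometrically, and normalisation of both `g` and the final
populations forces `m ≤ 1 ≤ M`; all ratios are therefore close to 1. -/
theorem QubitAchievable.populations (hg : IsGibbsOnSupport β θ g) (hθ : Function.Injective θ)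
    (hg1 : ∑ x, g x = 1) {δ : ℝ} (hδ : 0 < δ) :
    QubitAchievable β θ fun ω ω' => (∀ x, g x = 0 → ω x x = 0) →
      ∀ x, |(ω' x x).re - g x| ≤ δ := by
  obtain ⟨c, hc0, hc1, H⟩ := QubitAchievable.contraction hg hθ hg1
  have hiter : ∀ N : ℕ, QubitAchievable β θ fun ω ω' => ∀ m M, PopulationBounds g m M ω →
      ∃ m' M', M' - m' ≤ c ^ N * (M - m) ∧ PopulationBounds g m' M' ω' := by
    intro N
    induction N with
    | zero =>
      refine QubitAchievable.id.mono ?_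
      rintro ω _ - - rfl m M hb
      exact ⟨m, M, by simp, hb⟩
    | succ N ih =>
      refine (ih.comp H).mono ?_
      rintro ω ω'' - - ⟨ω', -, h1, h2⟩ m M hb
      obtain ⟨m', M', h3, hb'⟩ := h1 m M hb
      obtain ⟨m'', M'', h4, hb''⟩ := h2 m' M' hb'
      refine ⟨m'', M'', h4.trans ?_, hb''⟩
      rw [pow_succ', mul_assoc]
      exact mul_le_mul_of_nonneg_left h3 hc0
  have hg0 := hg.nonneg
  -- An initial upper bound for the ratios, uniform in the state; levels with `g x = 0` contribute
  -- `0⁻¹ = 0`.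
  set B := ∑ x, (g x)⁻¹
  have hB : 0 ≤ B := Finset.sum_nonneg fun x _ => inv_nonneg.2 (hg0 x)
  obtain ⟨N, hN⟩ : ∃ N : ℕ, c ^ N * B ≤ δ := by
    have : Filter.Tendsto (fun N : ℕ => c ^ N * B) Filter.atTop (nhds (0 * B)) :=
      (tendsto_pow_atTop_nhds_zero_of_lt_one hc0 hc1).mul_const B
    rw [zero_mul] at this
    exact ((this.eventually (gt_mem_nhds hδ)).exists).imp fun N h => h.le
  refine (hiter N).mono ?_
  intro ω ω' hω hω' H hsupp x
  have hb : PopulationBounds g 0 B ω := by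
    intro x
    rw [zero_mul]
    refine ⟨hω.re_apply_nonneg x, ?_⟩
    by_cases hx : g x = 0
    · simp [hsupp x hx, hx]
    · have h1 : (g x)⁻¹ ≤ B := Finset.single_le_sum (f := fun x => (g x)⁻¹)
        (fun y _ => inv_nonneg.2 (hg0 y)) (Finset.mem_univ x)
      calc (ω x x).re ≤ 1 := hω.re_apply_le_one x
        _ = (g x)⁻¹ * g x := (inv_mul_cancel₀ hx).symm
        _ ≤ B * g x := mul_le_mul_of_nonneg_right h1 (hg0 x)
  obtain ⟨m, M, h1, h2⟩ := H 0 B hb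
  have hm : m ≤ 1 := by
    have := Finset.sum_le_sum fun x (_ : x ∈ Finset.univ) => (h2 x).1
    rwa [hω'.sum_re_apply, ← Finset.mul_sum, hg1, mul_one] at this
  have hM : 1 ≤ M := by
    have := Finset.sum_le_sum fun x (_ : x ∈ Finset.univ) => (h2 x).2
    rwa [hω'.sum_re_apply, ← Finset.mul_sum, hg1, mul_one] at this
  have hgx : g x ≤ 1 := by
    rw [← hg1]
    exact Finset.single_le_sum (fun y _ => hg0 y) (Finset.mem_univ x)
  rw [sub_zero] at h1
  obtain ⟨h3, h4⟩ := h2 x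
  have h5 := hg0 x
  rw [abs_le]
  constructor <;> nlinarith

/-- A sign flip of one level, triggered with probability `w`, multiplies its coherences by `1 - 2 *
w`, of modulus below 1 because `0 < w < 1`. Populations are untouched. -/
theorem QubitAchievable.dephasing (hn : 0 < n) {δ : ℝ} (hδ : 0 < δ) :
    QubitAchievable β θ fun ω ω' => (∀ x, ω' x x = ω x x) ∧ ∀ x y, x ≠ y → ‖ω' x y‖ ≤ δ := by
  have hy : (fun _ => 1 : Fin n → ℝ) ≠ 0 := fun e => by simpa using congrFun e ⟨0, hn⟩
  set w := excitedPopulation β (fun _ => 1 : Fin n → ℝ)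
  have hw0 : 0 < w := excitedPopulation_pos _ _
  have hw1 : w < 1 := excitedPopulation_lt_one _ _
  set r := |1 - 2 * w|
  have hr1 : r < 1 := abs_lt.2 ⟨by linarith, by linarith⟩
  have hr0 : 0 ≤ r := abs_nonneg _
  have hS : ∀ S : Finset X, QubitAchievable β θ fun ω ω' => (∀ x, ω' x x = ω x x) ∧
      ∀ x y, x ≠ y → ‖ω' x y‖ ≤ ‖ω x y‖ ∧ (x ∈ S → ‖ω' x y‖ ≤ r * ‖ω x y‖) := by
    intro S
    induction S using Finset.induction_on with
    | empty =>
      refine QubitAchievable.id.mono ?_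
      rintro ω _ - - rfl
      simp
    | insert x₀ S _ ih =>
      refine (ih.comp (qubitAchievable_signFlip hy x₀)).mono ?_
      rintro ω ω'' - - ⟨ω', -, ⟨h1, h2⟩, h3⟩
      have h0 : ∀ x, ω'' x x = ω' x x := by
        intro x
        rw [h3]
        split_ifs <;> simp
      have hneg : ‖(1 : ℂ) - w + -1 * w‖ = r := by
        rw [show (1 : ℂ) - w + -1 * w = ((1 - 2 * w : ℝ) : ℂ) by push_cast; ring,
          Complex.norm_real, Real.norm_eq_abs]
      have hle : ∀ x y, x ≠ y → ‖ω'' x y‖ ≤ ‖ω' x y‖ := by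
        intro x y hxy
        rw [h3, norm_mul]
        refine mul_le_of_le_one_right (norm_nonneg _) ?_
        by_cases hx : x = x₀
        · subst hx
          simp only [if_true, if_neg hxy.symm, mul_one]
          exact hneg.trans_le hr1.le
        · by_cases hy : y = x₀
          · simp only [if_neg hx, if_pos hy, one_mul]
            exact hneg.trans_le hr1.le
          · simp [hx, hy]
      refine ⟨fun x => (h0 x).trans (h1 x), fun x y hxy =>
        ⟨(hle x y hxy).trans (h2 x y hxy).1, fun hx => ?_⟩⟩
      rcases Finset.mem_insert.1 hx with rfl | hx
      · rw [h3, if_pos rfl, if_neg hxy.symm, mul_one, norm_mul, mul_comm]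
        exact mul_le_mul hneg.le (h2 x y hxy).1 (norm_nonneg _) hr0
      · exact (hle x y hxy).trans ((h2 x y hxy).2 hx)
  have hiter : ∀ N : ℕ, QubitAchievable β θ fun ω ω' => (∀ x, ω' x x = ω x x) ∧
      ∀ x y, x ≠ y → ‖ω' x y‖ ≤ r ^ N * ‖ω x y‖ := by
    intro N
    induction N with
    | zero =>
      refine QubitAchievable.id.mono ?_
      rintro ω _ - - rfl
      simp
    | succ N ih =>
      refine (ih.comp (hS Finset.univ)).mono ?_
      rintro ω ω'' - - ⟨ω', -, ⟨h1, h2⟩, h3, h4⟩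
      refine ⟨fun x => (h3 x).trans (h1 x), fun x y hxy =>
        ((h4 x y hxy).2 (Finset.mem_univ x)).trans ?_⟩
      rw [pow_succ', mul_assoc]
      exact mul_le_mul_of_nonneg_left (h2 x y hxy) hr0
  obtain ⟨N, hN⟩ := exists_pow_lt_of_lt_one hδ hr1
  refine (hiter N).mono ?_
  rintro ω ω' hω - ⟨h1, h2⟩
  refine ⟨h1, fun x y hxy => (h2 x y hxy).trans ?_⟩
  exact (mul_le_of_le_one_right (by positivity) (hω.norm_apply_le_one x y)).trans hN.le

/-- The order matters: dephasing preserves populations, whereas the swaps come with no control over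
coherences. -/
theorem QubitAchievable.thermalisation (hn : 0 < n) (hg : IsGibbsOnSupport β θ g)
    (hθ : Function.Injective θ) (hg1 : ∑ x, g x = 1) {δ : ℝ} (hδ : 0 < δ) :
    QubitAchievable β θ fun ω ω' => (∀ x, g x = 0 → ω x x = 0) →
      ∀ x y, ‖ω' x y - Matrix.diagonal (fun x => (g x : ℂ)) x y‖ ≤ δ := by
  refine ((QubitAchievable.populations hg hθ hg1 hδ).comp
    (QubitAchievable.dephasing hn hδ)).mono ?_
  rintro ω ω'' - - ⟨ω', hω', h1, h2, h3⟩ hsupp x y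
  by_cases hxy : x = y
  · subst hxy
    rw [Matrix.diagonal_apply_eq, h2, hω'.apply_self_eq, ← Complex.ofReal_sub, Complex.norm_real]
    exact h1 hsupp x
  · rw [Matrix.diagonal_apply_ne _ hxy, sub_zero]
    exact h3 x y hxy

end Thermalisation

/-! ### Generalised Gibbs ensembles -/

section GibbsEnsemble

variable {ι : Type*} [Fintype ι] {n : ℕ}

/-- The Boltzmann weights of the levels with charges `q`. -/
def gibbsWeight (q : ι → Fin n → ℝ) (lam : Fin n → ℝ) (i : ι) : ℝ :=
  Real.exp (-(lam ⬝ᵥ q i)) / ∑ k, Real.exp (-(lam ⬝ᵥ q k))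

theorem sum_exp_pos [Nonempty ι] (q : ι → Fin n → ℝ) (lam : Fin n → ℝ) :
    0 < ∑ k, Real.exp (-(lam ⬝ᵥ q k)) :=
  Finset.sum_pos (fun _ _ => Real.exp_pos _) Finset.univ_nonempty

theorem gibbsWeight_pos [Nonempty ι] (q : ι → Fin n → ℝ) (lam : Fin n → ℝ) (i : ι) :
    0 < gibbsWeight q lam i :=
  div_pos (Real.exp_pos _) (sum_exp_pos q lam)

theorem sum_gibbsWeight [Nonempty ι] (q : ι → Fin n → ℝ) (lam : Fin n → ℝ) :
    ∑ i, gibbsWeight q lam i = 1 := by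
  simp only [gibbsWeight]
  rw [← Finset.sum_div, div_self (sum_exp_pos q lam).ne']

theorem log_gibbsWeight [Nonempty ι] (q : ι → Fin n → ℝ) (lam : Fin n → ℝ) (i : ι) :
    Real.log (gibbsWeight q lam i) =
      -(lam ⬝ᵥ q i) - Real.log (∑ k, Real.exp (-(lam ⬝ᵥ q k))) := by
  rw [gibbsWeight, Real.log_div (Real.exp_pos _).ne' (sum_exp_pos q lam).ne', Real.log_exp]

/-- Log-weights are affine in the charges, so this cross-entropy depends on `p` only through its
mean charges. -/
theorem sum_mul_log_gibbsWeight [Nonempty ι] {q : ι → Fin n → ℝ} {v : Fin n → ℝ} {p : ι → ℝ}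
    (hp : ∑ i, p i = 1) (hv : ∀ j, ∑ i, p i * q i j = v j) (lam : Fin n → ℝ) :
    ∑ i, p i * Real.log (gibbsWeight q lam i) =
      -(lam ⬝ᵥ v) - Real.log (∑ k, Real.exp (-(lam ⬝ᵥ q k))) := by
  simp only [log_gibbsWeight, mul_sub, mul_neg, Finset.sum_sub_distrib, Finset.sum_neg_distrib,
    ← Finset.sum_mul, hp, one_mul]
  congr 2
  simp only [dotProduct, Finset.mul_sum, ← hv]
  rw [Finset.sum_comm]
  exact Finset.sum_congr rfl fun j _ => Finset.sum_congr rfl fun i _ => by ring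

/-- Limits of Boltzmann distributions with prescribed mean charges are Boltzmann distributions on
their support, and every distribution with the same mean charges is supported there. -/
theorem exists_multiplier_of_tendsto_gibbsWeight [Nonempty ι] {q : ι → Fin n → ℝ}
    {v : Fin n → ℝ} {g : ι → ℝ} {lam : ℕ → Fin n → ℝ}
    (hlim : ∀ i, Filter.Tendsto (fun k => gibbsWeight q (lam k) i) Filter.atTop (nhds (g i)))
    (hg1 : ∑ i, g i = 1) (hgv : ∀ j, ∑ i, g i * q i j = v j) :
    (∃ (μ : Fin n → ℝ) (c : ℝ), 0 < c ∧ ∀ i, g i = 0 ∨ g i = c * Real.exp (-(μ ⬝ᵥ q i))) ∧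
    ∀ p : ι → ℝ, (∀ i, 0 ≤ p i) → ∑ i, p i = 1 → (∀ j, ∑ i, p i * q i j = v j) →
      ∀ i, g i = 0 → p i = 0 := by
  have hg0 : ∀ i, 0 ≤ g i := fun i =>
    ge_of_tendsto' (hlim i) fun k => (gibbsWeight_pos q (lam k) i).le
  have hlog : ∀ i, g i ≠ 0 → Filter.Tendsto (fun k => Real.log (gibbsWeight q (lam k) i))
      Filter.atTop (nhds (Real.log (g i))) := fun i hi => (hlim i).log hi
  refine ⟨?_, ?_⟩
  -- On the support, the log-weights lie in the range of `Λ`, a finite-dimensional and hence closed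
  -- subspace. Their limit lies there too, even if the multipliers `lam k` diverge.
  · let Λ : ((Fin n → ℝ) × ℝ) →ₗ[ℝ] ({i // g i ≠ 0} → ℝ) :=
      { toFun := fun z i => -(z.1 ⬝ᵥ q i) + z.2
        map_add' := fun z z' => by
          funext i
          simp only [Prod.fst_add, add_dotProduct, Prod.snd_add, Pi.add_apply]
          ring
        map_smul' := fun a z => by
          funext i
          simp only [Prod.smul_fst, smul_dotProduct, Prod.smul_snd, Pi.smul_apply, smul_eq_mul,
            RingHom.id_apply]
          ring }
    have hcl : IsClosed (LinearMap.range Λ : Set ({i // g i ≠ 0} → ℝ)) :=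
      Submodule.closed_of_finiteDimensional _
    have hmem : (fun i : {i // g i ≠ 0} => Real.log (g i)) ∈ LinearMap.range Λ := by
      refine hcl.mem_of_tendsto (b := Filter.atTop)
        (f := fun k (i : {i // g i ≠ 0}) => Real.log (gibbsWeight q (lam k) i))
        (tendsto_pi_nhds.2 fun i => hlog i i.2) (Filter.Eventually.of_forall fun k => ?_)
      refine ⟨(lam k, -Real.log (∑ l, Real.exp (-(lam k ⬝ᵥ q l)))), ?_⟩
      funext i
      rw [log_gibbsWeight]
      rfl
    obtain ⟨⟨μ, c⟩, hμ⟩ := hmem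
    refine ⟨μ, Real.exp c, Real.exp_pos c, fun i => or_iff_not_imp_left.2 fun hi => ?_⟩
    have h : -(μ ⬝ᵥ q i) + c = Real.log (g i) := congrFun hμ ⟨i, hi⟩
    rw [← Real.exp_add, add_comm, h, Real.exp_log (lt_of_le_of_ne (hg0 i) (Ne.symm hi))]
  · classical
    intro p hp0 hp1 hpv i hgi
    by_contra hpi
    have hpi : 0 < p i := lt_of_le_of_ne (hp0 i) (Ne.symm hpi)
    -- `p` and `g` have equal mean charges, hence equal cross-entropy for each `k`; computed with
    -- `g`, it has a finite limit.
    have h1 : Filter.Tendsto (fun k => ∑ i, p i * Real.log (gibbsWeight q (lam k) i))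
        Filter.atTop (nhds (∑ i, g i * Real.log (g i))) := by
      simp only [sum_mul_log_gibbsWeight hp1 hpv]
      simp only [← sum_mul_log_gibbsWeight hg1 hgv]
      refine tendsto_finsetSum _ fun i _ => ?_
      by_cases hi : g i = 0
      · simp [hi]
      · exact (hlog i hi).const_mul _
    -- Population of `p` outside the support would send this one term to `-∞`; the other terms are
    -- nonpositive and cannot compensate.
    have h2 : Filter.Tendsto (fun k => p i * Real.log (gibbsWeight q (lam k) i))
        Filter.atTop Filter.atBot := by
      refine Filter.Tendsto.const_mul_atBot hpi (Real.tendsto_log_nhdsGT_zero.comp ?_)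
      refine tendsto_nhdsWithin_iff.2 ⟨?_, Filter.Eventually.of_forall fun k =>
        gibbsWeight_pos q (lam k) i⟩
      simpa [hgi] using hlim i
    refine not_tendsto_nhds_of_tendsto_atBot (Filter.tendsto_atBot_mono (fun k => ?_) h2) _ h1
    rw [← Finset.add_sum_erase _ _ (Finset.mem_univ i)]
    refine add_le_of_nonpos_right (Finset.sum_nonpos fun l _ => ?_)
    refine mul_nonpos_of_nonneg_of_nonpos (hp0 l) (Real.log_nonpos (gibbsWeight_pos _ _ _).le ?_)
    rw [← sum_gibbsWeight q (lam k)]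
    exact Finset.single_le_sum (fun i _ => (gibbsWeight_pos q (lam k) i).le) (Finset.mem_univ l)

variable [DecidableEq ι]

theorem trace_mul_conj_diagonal (V ρ : Matrix ι ι ℂ) (q : ι → ℂ) :
    (ρ * (V * Matrix.diagonal q * Vᴴ)).trace = ∑ i, (Vᴴ * ρ * V) i i * q i := by
  rw [← mul_assoc, Matrix.trace_mul_comm, ← mul_assoc, ← mul_assoc, Matrix.trace]
  simp [Matrix.mul_diagonal]

theorem unitary_conj_conj {V : Matrix ι ι ℂ} (hV : V ∈ Matrix.unitaryGroup ι ℂ)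
    (M : Matrix ι ι ℂ) : Vᴴ * (V * M * Vᴴ) * V = M := by
  have h : Vᴴ * V = 1 := Matrix.mem_unitaryGroup_iff'.1 hV
  calc Vᴴ * (V * M * Vᴴ) * V = (Vᴴ * V) * M * (Vᴴ * V) := by simp only [mul_assoc]
    _ = M := by rw [h, one_mul, mul_one]

theorem IsGeneralisedGibbsEnsemble.exists_weights [Nonempty ι] {Q : Fin n → Matrix ι ι ℂ}
    {V : Matrix ι ι ℂ} (hV : V ∈ Matrix.unitaryGroup ι ℂ) {q : ι → Fin n → ℝ}
    (hq : ∀ j, Q j = V * Matrix.diagonal (fun i => (q i j : ℂ)) * Vᴴ)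
    {v : Fin n → ℝ} {γ : Matrix ι ι ℂ} (hγ : IsGeneralisedGibbsEnsemble v Q γ) :
    ∃ g : ι → ℝ, (∀ i, 0 ≤ g i) ∧ ∑ i, g i = 1 ∧
      γ = V * Matrix.diagonal (fun i => (g i : ℂ)) * Vᴴ ∧
      (∃ (μ : Fin n → ℝ) (c : ℝ), 0 < c ∧ ∀ i, g i = 0 ∨ g i = c * Real.exp (-(μ ⬝ᵥ q i))) ∧
      ∀ ρ ∈ compatibleStates v Q, ∀ i, g i = 0 → (Vᴴ * ρ * V) i i = 0 := by
  set D : Matrix ι ι ℂ → ι → ℝ := fun M i => ((Vᴴ * M * V) i i).re with hD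
  have hDc : Continuous D := continuous_pi fun i =>
    Complex.continuous_re.comp (Continuous.matrix_elem (by fun_prop) i i)
  have hDV : ∀ g : ι → ℝ, D (V * Matrix.diagonal (fun i => (g i : ℂ)) * Vᴴ) = g := by
    intro g
    funext i
    simp only [hD, unitary_conj_conj hV, Matrix.diagonal_apply_eq, Complex.ofReal_re]
  have hG : ∀ lam, gibbsState lam Q =
      V * Matrix.diagonal (fun i => (gibbsWeight q lam i : ℂ)) * Vᴴ :=
    fun lam => gibbsState_of_diagonal hV hq lam
  have hγeq : γ = V * Matrix.diagonal (fun i => (D γ i : ℂ)) * Vᴴ := by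
    -- Being diagonal in the basis `V` with real entries is a closed condition, so it passes from
    -- Gibbs states to their limits.
    have hcl : IsClosed {M : Matrix ι ι ℂ |
        M = V * Matrix.diagonal (fun i => (D M i : ℂ)) * Vᴴ} := by
      have hc : Continuous fun (M : Matrix ι ι ℂ) (i : ι) => (D M i : ℂ) :=
        continuous_pi fun i => Complex.continuous_ofReal.comp ((continuous_apply i).comp hDc)
      exact isClosed_eq continuous_id
        ((continuous_const.matrix_mul hc.matrix_diagonal).matrix_mul continuous_const)
    refine closure_minimal ?_ hcl hγ.1
    rintro _ ⟨lam, rfl⟩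
    simp only [Set.mem_ofPred_eq]
    rw [hG, hDV]
  have hmem : D γ ∈ closure (Set.range (gibbsWeight q)) := by
    have h := image_closure_subset_closure_image hDc (Set.mem_image_of_mem D hγ.1)
    rw [← Set.range_comp] at h
    convert h using 3
    funext lam
    simp only [Function.comp_apply, hG, hDV]
  obtain ⟨u, hu, hlim⟩ := mem_closure_iff_seq_limit.1 hmem
  choose lam hlam using hu
  obtain rfl : (fun k => gibbsWeight q (lam k)) = u := funext hlam
  have hlim' := tendsto_pi_nhds.1 hlim
  have hg1 : ∑ i, D γ i = 1 := by
    refine tendsto_nhds_unique (tendsto_finsetSum _ fun i _ => hlim' i) ?_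
    simp only [sum_gibbsWeight]
    exact tendsto_const_nhds
  have hmean : ∀ ρ : Matrix ι ι ℂ, ∀ j, ((ρ * Q j).trace).re = ∑ i, D ρ i * q i j := by
    intro ρ j
    rw [hq, trace_mul_conj_diagonal, Complex.re_sum]
    simp [hD]
  have hgv : ∀ j, ∑ i, D γ i * q i j = v j := by
    intro j
    rw [← hmean, hγ.2, Complex.ofReal_re]
  obtain ⟨h1, h2⟩ := exists_multiplier_of_tendsto_gibbsWeight hlim' hg1 hgv
  refine ⟨D γ, fun i => ge_of_tendsto' (hlim' i) fun k => (gibbsWeight_pos q _ i).le, hg1, hγeq,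
    h1, ?_⟩
  rintro ρ ⟨hρ, hρv⟩ i hi
  have hd : IsDensityMatrix (Vᴴ * ρ * V) := by
    simpa [Matrix.star_eq_conjTranspose] using hρ.conj (Unitary.star_mem hV)
  have h3 : D ρ i = 0 := by
    refine h2 (D ρ) (fun i => hd.re_apply_nonneg i) hd.sum_re_apply (fun j => ?_) i hi
    rw [← hmean, hρv, Complex.ofReal_re]
  rw [hd.apply_self_eq, Complex.ofReal_eq_zero]
  exact h3

end GibbsEnsemble

/-! ### Gibbs states -/

section GibbsStates

variable {ι : Type*} [Fintype ι] [DecidableEq ι] {n : ℕ}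

theorem isDensityMatrix_diagonal {g : ι → ℝ} (hg : ∀ i, 0 ≤ g i) (hg1 : ∑ i, g i = 1) :
    IsDensityMatrix (Matrix.diagonal fun i => (g i : ℂ)) := by
  refine ⟨Matrix.PosSemidef.diagonal fun i => Complex.zero_le_real.2 (hg i), ?_⟩
  rw [Matrix.trace_diagonal, ← Complex.ofReal_sum, hg1, Complex.ofReal_one]

theorem gibbsState_mem_compatibleStates [Nonempty ι] {Q : Fin n → Matrix ι ι ℂ}
    (hQ : IsCommutingObservables Q) (lam : Fin n → ℝ) :
    gibbsState lam Q ∈ compatibleStates (fun j => (gibbsState lam Q * Q j).trace.re) Q := by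
  obtain ⟨V, hV, q, hq⟩ := hQ.exists_diagonal
  have h : gibbsState lam Q = V * Matrix.diagonal (fun i => (gibbsWeight q lam i : ℂ)) * Vᴴ :=
    gibbsState_of_diagonal hV hq lam
  refine ⟨?_, fun j => ?_⟩
  · rw [h]
    exact (isDensityMatrix_diagonal (fun i => (gibbsWeight_pos q lam i).le)
      (sum_gibbsWeight q lam)).conj hV
  · have : (gibbsState lam Q * Q j).trace = ((∑ i, gibbsWeight q lam i * q i j : ℝ) : ℂ) := by
      rw [hq, trace_mul_conj_diagonal, h, unitary_conj_conj hV]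
      simp
    simp only [this, Complex.ofReal_re]

/-- The charges of a qubit with charge gap `x`. -/
def qubitObservable (x : Fin n → ℝ) (j : Fin n) : Matrix (Fin 2) (Fin 2) ℂ :=
  Matrix.diagonal fun i => ((((i : ℕ) : ℝ) * x j : ℝ) : ℂ)

theorem isCommutingObservables_qubitObservable (x : Fin n → ℝ) :
    IsCommutingObservables (qubitObservable x) := by
  refine ⟨fun j => ?_, fun i j => Matrix.commute_diagonal _ _⟩
  rw [Matrix.IsHermitian, qubitObservable, Matrix.diagonal_conjTranspose]
  congr 1
  funext i
  exact Complex.conj_ofReal _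

theorem trace_mul_qubitObservable (σ : Matrix (Fin 2) (Fin 2) ℂ) (x : Fin n → ℝ) (j : Fin n) :
    (σ * qubitObservable x j).trace = σ 1 1 * x j := by
  simp [Matrix.trace_fin_two, qubitObservable, Matrix.mul_diagonal]

theorem gibbsState_qubitObservable_apply (β x : Fin n → ℝ) :
    gibbsState β (qubitObservable x) 1 1 = excitedPopulation β x := by
  rw [gibbsState_of_diagonal (V := 1) (one_mem _) (q := fun (i : Fin 2) j => ((i : ℕ) : ℝ) * x j)
    (fun j => by simp [qubitObservable])]
  have h0 : β ⬝ᵥ (fun j => ((0 : ℕ) : ℝ) * x j) = 0 := by simp [dotProduct]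
  have h1 : β ⬝ᵥ (fun j => ((1 : ℕ) : ℝ) * x j) = β ⬝ᵥ x := by simp
  simp only [Matrix.conjTranspose_one, one_mul, mul_one, Matrix.diagonal_apply_eq,
    Fin.sum_univ_two, Fin.val_zero, Fin.val_one, h0, h1, neg_zero, Real.exp_zero, excitedPopulation]

/-- One nonzero component of the gap already determines the excited population from the mean charge;
the coherence stays free. -/
theorem isQubitState_of_mem_compatibleStates {β x : Fin n → ℝ} (hx : x ≠ 0)
    {σ : Matrix (Fin 2) (Fin 2) ℂ}
    (hσ : σ ∈ compatibleStates
      (fun j => (gibbsState β (qubitObservable x) * qubitObservable x j).trace.re)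
      (qubitObservable x)) : IsQubitState (excitedPopulation β x) σ := by
  refine ⟨hσ.1, ?_⟩
  obtain ⟨j, hj⟩ := Function.ne_iff.1 hx
  have h := hσ.2 j
  simp only [trace_mul_qubitObservable, gibbsState_qubitObservable_apply] at h
  rw [← Complex.ofReal_mul, Complex.ofReal_re, Complex.ofReal_mul] at h
  exact mul_right_cancel₀ (Complex.ofReal_ne_zero.2 hj) h

end GibbsStates

/-! ### Environments extended by qubits -/

section SubmatrixKronecker

variable {X A B C : Type*}

theorem kronecker_submatrix (f : C ≃ A × B) (P : Matrix X X ℂ) (M : Matrix A A ℂ)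
    (N : Matrix B B ℂ) :
    P ⊗ₖ (M ⊗ₖ N).submatrix f f =
      ((P ⊗ₖ M) ⊗ₖ N).submatrix (splitEquiv X f) (splitEquiv X f) := by
  ext p q
  simp [splitEquiv_apply, mul_assoc]

variable [DecidableEq A] [DecidableEq B]

theorem submatrix_sum_kronecker_add {I J : Type*} [Fintype I] [Fintype J] (f : C ≃ A × B) (G : I → Matrix A A ℂ)
    (H : J → Matrix B B ℂ) :
    ((∑ l, G l) ⊗ₖ (1 : Matrix B B ℂ) + (1 : Matrix A A ℂ) ⊗ₖ ∑ l, H l).submatrix f f =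
      ∑ l, (G l ⊗ₖ (1 : Matrix B B ℂ)).submatrix f f +
        ∑ l, ((1 : Matrix A A ℂ) ⊗ₖ H l).submatrix f f := by
  ext p q
  simp [Matrix.sum_apply, Finset.sum_mul, Finset.mul_sum]

theorem kronecker_add_kronecker_submatrix [DecidableEq X] [DecidableEq C] (f : C ≃ A × B) (P : Matrix X X ℂ)
    (M : Matrix A A ℂ) (N : Matrix B B ℂ) :
    P ⊗ₖ (1 : Matrix C C ℂ) + (1 : Matrix X X ℂ) ⊗ₖ
        (M ⊗ₖ (1 : Matrix B B ℂ) + (1 : Matrix A A ℂ) ⊗ₖ N).submatrix f f =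
      ((P ⊗ₖ (1 : Matrix A A ℂ) + (1 : Matrix X X ℂ) ⊗ₖ M) ⊗ₖ (1 : Matrix B B ℂ) +
        (1 : Matrix (X × A) (X × A) ℂ) ⊗ₖ N).submatrix (splitEquiv X f) (splitEquiv X f) := by
  have h1 : (1 : Matrix C C ℂ) =
      ((1 : Matrix A A ℂ) ⊗ₖ (1 : Matrix B B ℂ)).submatrix f f := by
    rw [Matrix.one_kronecker_one, Matrix.submatrix_one_equiv]
  rw [h1, ← Matrix.one_kronecker_one (m := X) (n := A)]
  ext p q
  simp only [Matrix.add_apply, Matrix.submatrix_apply, Matrix.kroneckerMap_apply, splitEquiv_apply]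
  ring

end SubmatrixKronecker

namespace ChargedEnvironment

variable {n : ℕ} (E : ChargedEnvironment n)

instance (l : Fin E.N) : Nonempty (Fin (E.dim l)) := ⟨⟨0, E.dim_pos l⟩⟩

theorem totalCharge_eq (j : Fin n) : E.totalCharge j = ∑ l, tensorPi (Function.update
    (fun m => (1 : Matrix (Fin (E.dim m)) (Fin (E.dim m)) ℂ)) l (E.charge l j)) := rfl

theorem trace_tensorFamily_mul_totalCharge
    {σ : ∀ l, Matrix (Fin (E.dim l)) (Fin (E.dim l)) ℂ} (hσ : ∀ l, IsDensityMatrix (σ l))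
    (j : Fin n) :
    (tensorFamily σ * E.totalCharge j).trace = ∑ l, (σ l * E.charge l j).trace := by
  rw [totalCharge_eq, Finset.mul_sum, Matrix.trace_sum]
  refine Finset.sum_congr rfl fun l _ => ?_
  rw [show tensorFamily σ = tensorPi σ from rfl, tensorPi_mul, trace_tensorPi,
    Finset.prod_eq_single l]
  · rw [Function.update_self]
  · intro m _ hm
    rw [Function.update_of_ne hm, mul_one, (hσ m).2]
  · simp

variable {L : Type} [Fintype L]

/-- The dimensions of the systems of an environment and of additional qubits. -/
def sumDim (L : Type) : Fin E.N ⊕ L → ℕ := Sum.elim E.dim fun _ => 2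

/-- The charges of the systems of an environment and of additional qubits. -/
def sumCharge (x : L → Fin n → ℝ) :
    ∀ s, Fin n → Matrix (Fin (E.sumDim L s)) (Fin (E.sumDim L s)) ℂ
  | Sum.inl l => E.charge l
  | Sum.inr l => qubitObservable (x l)

/-- The environment `E` extended by qubits with charge gaps `x`. -/
def addQubits (x : L → Fin n → ℝ) : ChargedEnvironment n where
  N := Fintype.card (Fin E.N ⊕ L)
  dim k := E.sumDim L ((Fintype.equivFin _).symm k)
  dim_pos k := by
    rcases (Fintype.equivFin (Fin E.N ⊕ L)).symm k with l | l
    · exact E.dim_pos l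
    · exact two_pos
  charge k := E.sumCharge x ((Fintype.equivFin _).symm k)
  charge_comm k := by
    rcases (Fintype.equivFin (Fin E.N ⊕ L)).symm k with l | l
    · exact E.charge_comm l
    · exact isCommutingObservables_qubitObservable (x l)

/-- The product basis of the extended environment. -/
def addQubitsIndex (x : L → Fin n → ℝ) : (E.addQubits x).Index ≃ E.Index × (L → Fin 2) :=
  (Equiv.piCongrLeft' (fun s => Fin (E.sumDim L s)) (Fintype.equivFin _)).symm.trans
    (Equiv.sumPiEquivProdPi _)

/-- Indices are first written as transports of families over `Fin E.N ⊕ L`; the product over the sum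
type then splits into its two halves. -/
theorem tensorFamily_addQubits (x : L → Fin n → ℝ)
    (s : ∀ i, Matrix (Fin (E.sumDim L i)) (Fin (E.sumDim L i)) ℂ) :
    (tensorFamily fun k => s ((Fintype.equivFin _).symm k) :
      Matrix (E.addQubits x).Index (E.addQubits x).Index ℂ) =
      ((tensorPi fun l => s (Sum.inl l) : Matrix E.Index E.Index ℂ) ⊗ₖ
        (tensorPi fun l => s (Sum.inr l) : Matrix (L → Fin 2) (L → Fin 2) ℂ)).submatrix
        (E.addQubitsIndex x) (E.addQubitsIndex x) := by
  have hidx : ∀ a : ∀ i, Fin (E.sumDim L i), E.addQubitsIndex x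
      (Equiv.piCongrLeft' (fun s => Fin (E.sumDim L s)) (Fintype.equivFin _) a) =
        (fun l => a (Sum.inl l), fun l => a (Sum.inr l)) := fun a =>
    congrArg (Equiv.sumPiEquivProdPi fun s => Fin (E.sumDim L s)) (Equiv.symm_apply_apply _ a)
  ext a b
  obtain ⟨a, rfl⟩ := (Equiv.piCongrLeft' (fun s => Fin (E.sumDim L s))
    (Fintype.equivFin _)).surjective a
  obtain ⟨b, rfl⟩ := (Equiv.piCongrLeft' (fun s => Fin (E.sumDim L s))
    (Fintype.equivFin _)).surjective b
  exact ((Equiv.prod_comp (Fintype.equivFin (Fin E.N ⊕ L)).symm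
    fun i => s i (a i) (b i)).trans (Fintype.prod_sum_type _)).trans
    (congrArg₂ ((tensorPi fun l => s (Sum.inl l) : Matrix E.Index E.Index ℂ) ⊗ₖ
      (tensorPi fun l => s (Sum.inr l) : Matrix (L → Fin 2) (L → Fin 2) ℂ))
      (hidx a) (hidx b)).symm

theorem mem_compatibleStates_addQubits {β : Fin n → ℝ} {x : L → Fin n → ℝ} (hx : ∀ l, x l ≠ 0)
    {σ : ∀ k, Matrix (Fin ((E.addQubits x).dim k)) (Fin ((E.addQubits x).dim k)) ℂ}
    (hσ : ∀ k, σ k ∈ compatibleStates ((E.addQubits x).thermalValue β k)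
      ((E.addQubits x).charge k)) :
    ∃ (ς : ∀ l, Matrix (Fin (E.dim l)) (Fin (E.dim l)) ℂ) (τ : L → Matrix (Fin 2) (Fin 2) ℂ),
      (∀ l, ς l ∈ compatibleStates (E.thermalValue β l) (E.charge l)) ∧
      (∀ l, IsQubitState (excitedPopulation β (x l)) (τ l)) ∧
      tensorFamily σ = (tensorFamily ς ⊗ₖ tensorPi τ).submatrix
        (E.addQubitsIndex x) (E.addQubitsIndex x) := by
  obtain ⟨s, rfl⟩ := (Equiv.piCongrLeft'
    (fun i => Matrix (Fin (E.sumDim L i)) (Fin (E.sumDim L i)) ℂ)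
    (Fintype.equivFin (Fin E.N ⊕ L))).surjective σ
  have hs : ∀ i, s i ∈ compatibleStates
      (fun j => (gibbsState β (E.sumCharge x i) * E.sumCharge x i j).trace.re)
      (E.sumCharge x i) :=
    (Fintype.equivFin (Fin E.N ⊕ L)).symm.surjective.forall.2 hσ
  exact ⟨fun l => s (Sum.inl l), fun l => s (Sum.inr l), fun l => hs (Sum.inl l),
    fun l => isQubitState_of_mem_compatibleStates (hx l) (hs (Sum.inr l)),
    E.tensorFamily_addQubits x s⟩

variable [DecidableEq L]

theorem totalCharge_addQubits (x : L → Fin n → ℝ) (j : Fin n) :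
    (E.addQubits x).totalCharge j =
      (E.totalCharge j ⊗ₖ (1 : Matrix (L → Fin 2) (L → Fin 2) ℂ) +
        (1 : Matrix E.Index E.Index ℂ) ⊗ₖ
          Matrix.diagonal fun a => ((qubitCharge x a j : ℝ) : ℂ)).submatrix
        (E.addQubitsIndex x) (E.addQubitsIndex x) := by
  have h1 : (E.addQubits x).totalCharge j = ∑ i : Fin E.N ⊕ L,
      (tensorFamily fun k => Function.update
        (fun m => (1 : Matrix (Fin (E.sumDim L m)) (Fin (E.sumDim L m)) ℂ)) i
        (E.sumCharge x i j) ((Fintype.equivFin _).symm k) :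
      Matrix (E.addQubits x).Index (E.addQubits x).Index ℂ) := by
    rw [← Equiv.sum_comp (Fintype.equivFin (Fin E.N ⊕ L)).symm]
    refine Finset.sum_congr rfl fun k _ => ?_
    congr 1
    funext k'
    by_cases hk : k' = k
    · subst hk
      rw [Function.update_self, Function.update_self]
      rfl
    · rw [Function.update_of_ne hk, Function.update_of_ne]
      · rfl
      · exact fun e => hk ((Fintype.equivFin (Fin E.N ⊕ L)).symm.injective e)
  have h2 : Matrix.diagonal (fun a => ((qubitCharge x a j : ℝ) : ℂ)) =
      ∑ l, tensorPi (Function.update (fun _ => (1 : Matrix (Fin 2) (Fin 2) ℂ)) l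
        (qubitObservable (x l) j)) := by
    have h3 : ∀ l, tensorPi (Function.update (fun _ => (1 : Matrix (Fin 2) (Fin 2) ℂ)) l
        (qubitObservable (x l) j)) =
        Matrix.diagonal fun a : L → Fin 2 => ((((a l : ℕ) : ℝ) * x l j : ℝ) : ℂ) := by
      intro l
      have h4 : Function.update (fun _ => (1 : Matrix (Fin 2) (Fin 2) ℂ)) l
          (qubitObservable (x l) j) = fun m => Matrix.diagonal (Function.update
            (fun _ _ => 1 : L → Fin 2 → ℂ) l (fun i => ((((i : ℕ) : ℝ) * x l j : ℝ) : ℂ)) m) := by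
        funext m
        by_cases hm : m = l
        · subst hm
          simp [qubitObservable]
        · simp [Function.update_of_ne hm]
      rw [h4, tensorPi_diagonal]
      congr 1
      funext a
      rw [Finset.prod_eq_single l]
      · rw [Function.update_self]
      · intro m _ hm
        rw [Function.update_of_ne hm]
      · simp
    simp only [h3]
    ext a b
    by_cases hab : a = b
    · subst hab
      simp [Matrix.sum_apply, qubitCharge]
    · simp [Matrix.sum_apply, hab]
  rw [h1]
  simp only [tensorFamily_addQubits]
  rw [Fintype.sum_sum_type, h2, totalCharge_eq, submatrix_sum_kronecker_add]
  congr 1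
  · refine Finset.sum_congr rfl fun l _ => congrArg (fun M => Matrix.submatrix M _ _) ?_
    congr 1
    · congr 1
      funext m
      by_cases hm : m = l
      · subst hm
        rw [Function.update_self, Function.update_self]
        rfl
      · rw [Function.update_of_ne hm, Function.update_of_ne fun e => hm (Sum.inl_injective e)]
        rfl
    · rw [← tensorPi_one]
      congr 1
  · refine Finset.sum_congr rfl fun l _ => congrArg (fun M => Matrix.submatrix M _ _) ?_
    congr 1
    · rw [← tensorPi_one]
      congr 1
    · congr 1
      funext m
      by_cases hm : m = l
      · subst hm
        rw [Function.update_self, Function.update_self]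
        rfl
      · rw [Function.update_of_ne hm, Function.update_of_ne fun e => hm (Sum.inr_injective e)]
        rfl

section Compound

variable {ι : Type*} [DecidableEq ι]

theorem compoundCharge_addQubits (x : L → Fin n → ℝ) (Q : Fin n → Matrix ι ι ℂ) (j : Fin n) :
    (E.addQubits x).compoundCharge Q j =
      (E.compoundCharge Q j ⊗ₖ (1 : Matrix (L → Fin 2) (L → Fin 2) ℂ) +
        (1 : Matrix (ι × E.Index) (ι × E.Index) ℂ) ⊗ₖ
          Matrix.diagonal fun a => ((qubitCharge x a j : ℝ) : ℂ)).submatrix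
        (splitEquiv ι (E.addQubitsIndex x)) (splitEquiv ι (E.addQubitsIndex x)) := by
  rw [compoundCharge, totalCharge_addQubits]
  exact kronecker_add_kronecker_submatrix _ _ _ _

theorem implements_addQubits [Fintype ι] {x : L → Fin n → ℝ} {Q : Fin n → Matrix ι ι ℂ}
    {W : Matrix ((ι × E.Index) × (L → Fin 2)) ((ι × E.Index) × (L → Fin 2)) ℂ}
    {ρf : Matrix ι ι ℂ} {ε ε' : ℝ} {ρ : Matrix ι ι ℂ}
    {σ : ∀ k, Matrix (Fin ((E.addQubits x).dim k)) (Fin ((E.addQubits x).dim k)) ℂ}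
    {ω : Matrix (ι × E.Index) (ι × E.Index) ℂ} {T : Matrix (L → Fin 2) (L → Fin 2) ℂ}
    (hω : ρ ⊗ₖ tensorFamily σ = (ω ⊗ₖ T).submatrix
      (splitEquiv ι (E.addQubitsIndex x)) (splitEquiv ι (E.addQubitsIndex x)))
    (h₁ : traceNorm (partialTraceRight (partialTraceRight (W * (ω ⊗ₖ T) * Wᴴ)) - ρf) ≤ ε)
    (h₂ : ∀ j, ‖(W * (ω ⊗ₖ T) * Wᴴ * (E.compoundCharge Q j ⊗ₖ 1 +
        1 ⊗ₖ Matrix.diagonal fun a => ((qubitCharge x a j : ℝ) : ℂ))).trace -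
      ((ω ⊗ₖ T) * (E.compoundCharge Q j ⊗ₖ 1 +
        1 ⊗ₖ Matrix.diagonal fun a => ((qubitCharge x a j : ℝ) : ℂ))).trace‖ ≤ ε') :
    (E.addQubits x).Implements Q (W.submatrix (splitEquiv ι (E.addQubitsIndex x))
      (splitEquiv ι (E.addQubitsIndex x))) ρf ε ε' ρ σ := by
  have htr : ∀ M : Matrix ((ι × E.Index) × (L → Fin 2)) ((ι × E.Index) × (L → Fin 2)) ℂ,
      (M.submatrix (splitEquiv ι (E.addQubitsIndex x))
        (splitEquiv ι (E.addQubitsIndex x))).trace = M.trace := fun M =>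
    Equiv.sum_comp (splitEquiv ι (E.addQubitsIndex x)) fun p => M p p
  refine ⟨?_, fun j => ?_⟩
  · rw [hω, conj_submatrix, partialTraceRight_submatrix_splitEquiv]
    exact h₁
  · rw [hω, conj_submatrix, compoundCharge_addQubits, Matrix.submatrix_mul_equiv,
      Matrix.submatrix_mul_equiv, htr, htr]
    exact h₂ j

end Compound

end ChargedEnvironment

/-- Matrices carry the product topology, so the sup metric on `X → X → ℂ` describes their
neighbourhoods. -/
theorem exists_entrywise_of_eventually {X : Type*} [Fintype X] {D : Matrix X X ℂ} {P : Matrix X X ℂ → Prop}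
    (h : ∀ᶠ M in nhds D, P M) : ∃ δ > 0, ∀ M, (∀ x y, ‖M x y - D x y‖ ≤ δ) → P M := by
  obtain ⟨r, hr, H⟩ := (Metric.eventually_nhds_iff (α := X → X → ℂ)).1 h
  refine ⟨r / 2, half_pos hr, fun M hM => H (lt_of_le_of_lt ?_ (half_lt_self hr))⟩
  refine (dist_pi_le_iff (half_pos hr).le).2 fun x => (dist_pi_le_iff (half_pos hr).le).2 fun y => ?_
  rw [dist_eq_norm]
  exact hM x y

/-! ### The charge balance of thermalisation followed by a unitary -/

section Balance

variable {X A : Type*} [Fintype X] [Fintype A] [DecidableEq A]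

theorem partialTraceRight_conj_kronecker_one (G : Matrix X X ℂ)
    (M : Matrix (X × A) (X × A) ℂ) :
    partialTraceRight ((G ⊗ₖ (1 : Matrix A A ℂ)) * M * (G ⊗ₖ (1 : Matrix A A ℂ))ᴴ) =
      G * partialTraceRight M * Gᴴ := by
  rw [Matrix.conjTranspose_kronecker, Matrix.conjTranspose_one,
    partialTraceRight_mul_kronecker_one, partialTraceRight_kronecker_one_mul]

/-- `W` is constructed in the eigenbasis given by `V`; the full unitary enters this basis,
thermalises, returns and applies `U`. -/
theorem thermalise_then_apply_eq (U V W) (ω : Matrix X X ℂ) (T : Matrix A A ℂ)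
    {Ξ : Matrix (X × A) (X × A) ℂ} (hΞ : Ξ = W * ((Vᴴ * ω * V) ⊗ₖ T) * Wᴴ) :
    ((U * V) ⊗ₖ (1 : Matrix A A ℂ) * W * (Vᴴ ⊗ₖ (1 : Matrix A A ℂ))) * (ω ⊗ₖ T) *
      ((U * V) ⊗ₖ (1 : Matrix A A ℂ) * W * (Vᴴ ⊗ₖ (1 : Matrix A A ℂ)))ᴴ =
    ((U * V) ⊗ₖ (1 : Matrix A A ℂ)) * Ξ * ((U * V) ⊗ₖ (1 : Matrix A A ℂ))ᴴ := by
  have h := conj_kronecker_one (A := A) Vᴴ ω T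
  rw [Matrix.conjTranspose_conjTranspose] at h
  rw [hΞ, ← h, Matrix.conjTranspose_mul, Matrix.conjTranspose_mul]
  simp only [mul_assoc]

variable [DecidableEq X]

theorem trace_unitary_conj {V : Matrix X X ℂ} (hV : V ∈ Matrix.unitaryGroup X ℂ)
    (M : Matrix X X ℂ) : (V * M * Vᴴ).trace = M.trace := by
  rw [Matrix.trace_mul_comm, ← mul_assoc, show Vᴴ * V = 1 from Matrix.mem_unitaryGroup_iff'.1 hV,
    one_mul]

theorem trace_conj_kronecker_one_mul {G : Matrix X X ℂ} (hG : G ∈ Matrix.unitaryGroup X ℂ)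
    (M : Matrix (X × A) (X × A) ℂ) (D : Matrix A A ℂ) :
    ((G ⊗ₖ (1 : Matrix A A ℂ)) * M * (G ⊗ₖ (1 : Matrix A A ℂ))ᴴ * (1 ⊗ₖ D)).trace =
      (M * ((1 : Matrix X X ℂ) ⊗ₖ D)).trace := by
  have h1 : (G ⊗ₖ (1 : Matrix A A ℂ))ᴴ * ((1 : Matrix X X ℂ) ⊗ₖ D) =
      (1 ⊗ₖ D) * (G ⊗ₖ (1 : Matrix A A ℂ))ᴴ := by
    rw [Matrix.conjTranspose_kronecker, Matrix.conjTranspose_one, ← Matrix.mul_kronecker_mul,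
      ← Matrix.mul_kronecker_mul]
    simp
  have h2 := trace_unitary_conj (kronecker_one_mem_unitaryGroup (A := A) hG)
    (M * ((1 : Matrix X X ℂ) ⊗ₖ D))
  rw [← h2]
  simp only [mul_assoc, h1]

/-- `W` conserves `t + c`, so the qubits gain in `c` exactly what the rest loses in `t`, and `U`
does not touch the qubits. The charge `C` that is balanced against `c` need not be related to `t`.
-/
theorem trace_charge_change {U V : Matrix X X ℂ} (hU : U ∈ Matrix.unitaryGroup X ℂ)
    (hV : V ∈ Matrix.unitaryGroup X ℂ) {W : Matrix (X × A) (X × A) ℂ}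
    (hW : W ∈ Matrix.unitaryGroup (X × A) ℂ) {t : X → ℂ} {c : A → ℂ}
    (hc : Commute W (Matrix.diagonal fun p => t p.1 + c p.2))
    (C ω : Matrix X X ℂ) {T : Matrix A A ℂ} (hT : T.trace = 1)
    {Ξ : Matrix (X × A) (X × A) ℂ} (hΞ : Ξ = W * ((Vᴴ * ω * V) ⊗ₖ T) * Wᴴ)
    {ω₁ : Matrix X X ℂ} (hω₁ : ω₁ = V * partialTraceRight Ξ * Vᴴ) :
    (((U * V) ⊗ₖ (1 : Matrix A A ℂ)) * Ξ * ((U * V) ⊗ₖ (1 : Matrix A A ℂ))ᴴ *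
        (C ⊗ₖ 1 + 1 ⊗ₖ Matrix.diagonal c)).trace -
      ((ω ⊗ₖ T) * (C ⊗ₖ 1 + 1 ⊗ₖ Matrix.diagonal c)).trace =
    (U * ω₁ * Uᴴ * C).trace - (ω * C).trace +
      ((ω - ω₁) * (V * Matrix.diagonal t * Vᴴ)).trace := by
  have hD : Matrix.diagonal (fun p : X × A => t p.1 + c p.2) =
      Matrix.diagonal t ⊗ₖ (1 : Matrix A A ℂ) + (1 : Matrix X X ℂ) ⊗ₖ Matrix.diagonal c := by
    rw [← Matrix.diagonal_one, ← Matrix.diagonal_one, Matrix.diagonal_kronecker_diagonal,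
      Matrix.diagonal_kronecker_diagonal, Matrix.diagonal_add]
    simp
  rw [hD] at hc
  set ω₀ := Vᴴ * ω * V
  have hcons : (Ξ * (Matrix.diagonal t ⊗ₖ (1 : Matrix A A ℂ) + 1 ⊗ₖ Matrix.diagonal c)).trace =
      ((ω₀ ⊗ₖ T) * (Matrix.diagonal t ⊗ₖ (1 : Matrix A A ℂ) + 1 ⊗ₖ Matrix.diagonal c)).trace := by
    set D := Matrix.diagonal t ⊗ₖ (1 : Matrix A A ℂ) + (1 : Matrix X X ℂ) ⊗ₖ Matrix.diagonal c
    have hWW : Wᴴ * W = 1 := Matrix.mem_unitaryGroup_iff'.1 hW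
    rw [hΞ, Matrix.trace_mul_comm, ← mul_assoc, ← mul_assoc, ← hc.eq, Matrix.trace_mul_comm,
      ← mul_assoc, ← mul_assoc, hWW, one_mul, Matrix.trace_mul_comm]
  have hG : U * V ∈ Matrix.unitaryGroup X ℂ := mul_mem hU hV
  have e1 : (((U * V) ⊗ₖ (1 : Matrix A A ℂ)) * Ξ * ((U * V) ⊗ₖ (1 : Matrix A A ℂ))ᴴ *
      (C ⊗ₖ (1 : Matrix A A ℂ))).trace = (U * ω₁ * Uᴴ * C).trace := by
    rw [trace_mul_kronecker_one, partialTraceRight_conj_kronecker_one, hω₁,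
      Matrix.conjTranspose_mul]
    simp only [mul_assoc]
  have e2 : (Ξ * (Matrix.diagonal t ⊗ₖ (1 : Matrix A A ℂ))).trace =
      (ω₁ * (V * Matrix.diagonal t * Vᴴ)).trace := by
    rw [trace_mul_kronecker_one, hω₁, trace_mul_conj_diagonal, unitary_conj_conj hV]
    simp [Matrix.trace, Matrix.mul_diagonal]
  have e3 : ∀ (ρ B : Matrix X X ℂ), ((ρ ⊗ₖ T) * (B ⊗ₖ (1 : Matrix A A ℂ))).trace =
      (ρ * B).trace := by
    intro ρ B
    rw [← Matrix.mul_kronecker_mul, Matrix.trace_kronecker, mul_one, hT, mul_one]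
  have e4 : ∀ ρ : Matrix X X ℂ, ((ρ ⊗ₖ T) * ((1 : Matrix X X ℂ) ⊗ₖ Matrix.diagonal c)).trace =
      ρ.trace * (T * Matrix.diagonal c).trace := by
    intro ρ
    rw [← Matrix.mul_kronecker_mul, Matrix.trace_kronecker, mul_one]
  have e5 : (ω₀ * Matrix.diagonal t).trace = (ω * (V * Matrix.diagonal t * Vᴴ)).trace := by
    rw [trace_mul_conj_diagonal]
    simp [Matrix.trace, Matrix.mul_diagonal, ω₀]
  have e6 : ω₀.trace = ω.trace := by
    have := trace_unitary_conj (Unitary.star_mem hV) ω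
    simpa [Matrix.star_eq_conjTranspose] using this
  rw [mul_add, mul_add, Matrix.trace_add, Matrix.trace_add, e2, e3, e4, e5, e6] at hcons
  rw [mul_add, mul_add, Matrix.trace_add, Matrix.trace_add, e1, e3, e4,
    trace_conj_kronecker_one_mul hG, sub_mul, Matrix.trace_sub]
  linear_combination hcons

end Balance

/-! ### Lifting degeneracies -/

section Perturbation

variable {X : Type*}

/-- Charges whose values are perturbed along a common direction to become nondegenerate. -/
def perturbedCharge {n : ℕ} (θ : X → Fin n → ℝ) (e : X → ℝ) (s : ℝ) (x : X) (j : Fin n) : ℝ :=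
  θ x j + s * e x

/-- In the first component two distinct levels collide for a single value of `s` only. There are
finitely many pairs, and the value `0` is excluded by the punctured neighbourhood. -/
theorem eventually_perturbedCharge_injective [Finite X] {n : ℕ} (hn : 0 < n) (θ : X → Fin n → ℝ)
    {e : X → ℝ} (he : Function.Injective e) :
    ∀ᶠ s in nhdsWithin (0 : ℝ) {0}ᶜ, Function.Injective (perturbedCharge θ e s) := by
  have h : ∀ x y : X, ∀ᶠ s in nhdsWithin (0 : ℝ) {0}ᶜ, x ≠ y →
      perturbedCharge θ e s x ≠ perturbedCharge θ e s y := by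
    intro x y
    by_cases hxy : x = y
    · simp [hxy]
    set a := -(θ x ⟨0, hn⟩ - θ y ⟨0, hn⟩) / (e x - e y)
    have hne : e x - e y ≠ 0 := sub_ne_zero.2 fun h => hxy (he h)
    have ha : ∀ᶠ s in nhdsWithin (0 : ℝ) {0}ᶜ, s ≠ a := by
      by_cases ha : a = 0
      · rw [ha]
        exact self_mem_nhdsWithin
      · exact (eventually_ne_nhds (Ne.symm ha)).filter_mono nhdsWithin_le_nhds
    filter_upwards [ha] with s hs _ heq
    apply hs
    have := congrFun heq ⟨0, hn⟩
    simp only [perturbedCharge] at this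
    rw [eq_div_iff hne]
    linarith
  filter_upwards [Filter.eventually_all.2 fun x => Filter.eventually_all.2 (h x)] with s hs x y hxy
  by_contra hne
  exact hs x y hne hxy

variable [Fintype X]

/-- The distribution `g` reweighted to the charges perturbed by `s • e`. -/
def perturbedWeight (g e : X → ℝ) (B s : ℝ) (x : X) : ℝ :=
  g x * Real.exp (-(s * e x * B)) / ∑ y, g y * Real.exp (-(s * e y * B))

theorem tendsto_perturbedWeight {g : X → ℝ} (hg1 : ∑ x, g x = 1) (e : X → ℝ) (B : ℝ) (x : X) :
    Filter.Tendsto (fun s => perturbedWeight g e B s x) (nhds 0) (nhds (g x)) := by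
  have h : ContinuousAt (fun s => perturbedWeight g e B s x) 0 := by
    refine ContinuousAt.div (by fun_prop) (by fun_prop) ?_
    simp [hg1]
  have h2 := h.tendsto
  have h3 : perturbedWeight g e B 0 x = g x := by simp [perturbedWeight, hg1]
  rwa [h3] at h2

/-- Adding `s * e x` to every component changes `β ⬝ᵥ θ x` by `s * e x * ∑ j, β j`, which is what
the exponential factor in the weight accounts for. -/
theorem perturbedWeight_properties {n : ℕ} {β : Fin n → ℝ} {θ : X → Fin n → ℝ} {g : X → ℝ}
    (hg : IsGibbsOnSupport β θ g) (hg1 : ∑ x, g x = 1) (e : X → ℝ) (s : ℝ) :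
    IsGibbsOnSupport β (perturbedCharge θ e s) (perturbedWeight g e (∑ j, β j) s) ∧
      ∑ x, perturbedWeight g e (∑ j, β j) s x = 1 ∧
      ∀ x, perturbedWeight g e (∑ j, β j) s x = 0 → g x = 0 := by
  set B := ∑ j, β j
  have hg0 := hg.nonneg
  have hZ : 0 < ∑ y, g y * Real.exp (-(s * e y * B)) := by
    refine lt_of_le_of_ne
      (Finset.sum_nonneg fun y _ => mul_nonneg (hg0 y) (Real.exp_pos _).le) fun h0 => ?_
    have := (Finset.sum_eq_zero_iff_of_nonneg
      fun y _ => mul_nonneg (hg0 y) (Real.exp_pos _).le).1 h0.symm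
    have h1 : ∑ x, g x = 0 := Finset.sum_eq_zero fun y hy =>
      (mul_eq_zero.1 (this y hy)).resolve_right (Real.exp_pos _).ne'
    rw [hg1] at h1
    exact one_ne_zero h1
  refine ⟨?_, ?_, ?_⟩
  · obtain ⟨c, hc, h⟩ := hg
    refine ⟨c / ∑ y, g y * Real.exp (-(s * e y * B)), div_pos hc hZ, fun x => ?_⟩
    have hdot : β ⬝ᵥ perturbedCharge θ e s x = β ⬝ᵥ θ x + s * e x * B := by
      simp only [dotProduct, perturbedCharge, mul_add, Finset.sum_add_distrib, B, Finset.mul_sum]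
      congr 1
      exact Finset.sum_congr rfl fun j _ => mul_comm _ _
    rcases h x with h | h
    · left
      simp [perturbedWeight, h]
    · right
      rw [perturbedWeight, hdot, neg_add, Real.exp_add, ← mul_assoc, div_mul_eq_mul_div,
        div_mul_eq_mul_div, ← h]
  · simp only [perturbedWeight]
    rw [← Finset.sum_div, div_self hZ.ne']
  · intro x hx
    rw [perturbedWeight, div_eq_zero_iff] at hx
    exact (mul_eq_zero.1 (hx.resolve_right hZ.ne')).resolve_right (Real.exp_pos _).ne'

end Perturbation

/-! ### Equivalence of a macrostate with its generalised Gibbs ensemble -/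

section ProductConj

variable {X A : Type*} [Fintype X] [Fintype A]

theorem kronecker_conj (V M : Matrix X X ℂ) (V' M' : Matrix A A ℂ) :
    (V ⊗ₖ V') * (M ⊗ₖ M') * (V ⊗ₖ V')ᴴ = (V * M * Vᴴ) ⊗ₖ (V' * M' * V'ᴴ) := by
  rw [Matrix.conjTranspose_kronecker, ← Matrix.mul_kronecker_mul, ← Matrix.mul_kronecker_mul]

theorem tensorPi_conj {L : Type*} [Fintype L] [DecidableEq L] {κ : L → Type*}
    [∀ l, Fintype (κ l)] (V M : ∀ l, Matrix (κ l) (κ l) ℂ) :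
    tensorPi V * tensorPi M * (tensorPi V)ᴴ = tensorPi fun l => V l * M l * (V l)ᴴ := by
  rw [tensorPi_conjTranspose, tensorPi_mul, tensorPi_mul]

end ProductConj

/-! ### Rescaled charges of the system with its environment. -/

namespace ChargedEnvironment

variable {n : ℕ} (E : ChargedEnvironment n) {ι : Type*} [Fintype ι] [DecidableEq ι]

theorem totalCharge_eq_conj_diagonal {V : ∀ l, Matrix (Fin (E.dim l)) (Fin (E.dim l)) ℂ}
    (hV : ∀ l, V l ∈ Matrix.unitaryGroup (Fin (E.dim l)) ℂ)
    {q : ∀ l, Fin (E.dim l) → Fin n → ℝ}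
    (hq : ∀ l j, E.charge l j = V l * Matrix.diagonal (fun i => (q l i j : ℂ)) * (V l)ᴴ)
    (j : Fin n) :
    E.totalCharge j = tensorPi V *
      Matrix.diagonal (fun a : E.Index => ((∑ l, q l (a l) j : ℝ) : ℂ)) * (tensorPi V)ᴴ := by
  have h : Matrix.diagonal (fun a : E.Index => ((∑ l, q l (a l) j : ℝ) : ℂ)) =
      ∑ l, tensorPi (Function.update
        (fun m => (1 : Matrix (Fin (E.dim m)) (Fin (E.dim m)) ℂ)) l
        (Matrix.diagonal fun i => (q l i j : ℂ))) := by
    have h1 : ∀ l, tensorPi (Function.update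
        (fun m => (1 : Matrix (Fin (E.dim m)) (Fin (E.dim m)) ℂ)) l
        (Matrix.diagonal fun i => (q l i j : ℂ))) =
        Matrix.diagonal fun a : E.Index => (q l (a l) j : ℂ) := by
      intro l
      have h2 : Function.update
          (fun m => (1 : Matrix (Fin (E.dim m)) (Fin (E.dim m)) ℂ)) l
          (Matrix.diagonal fun i => (q l i j : ℂ)) = fun m => Matrix.diagonal (Function.update
            (fun m (_ : Fin (E.dim m)) => (1 : ℂ)) l (fun i => (q l i j : ℂ)) m) := by
        funext m
        by_cases hm : m = l
        · subst hm
          simp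
        · simp [Function.update_of_ne hm]
      rw [h2, tensorPi_diagonal]
      congr 1
      funext a
      rw [Finset.prod_eq_single l]
      · rw [Function.update_self]
      · intro m _ hm
        rw [Function.update_of_ne hm]
      · simp
    simp only [h1]
    ext a b
    by_cases hab : a = b
    · subst hab
      simp [Matrix.sum_apply]
    · simp [Matrix.sum_apply, hab]
  rw [h, totalCharge_eq, Finset.mul_sum, Finset.sum_mul]
  refine Finset.sum_congr rfl fun l _ => ?_
  rw [tensorPi_conj]
  congr 1
  funext m
  by_cases hm : m = l
  · subst hm
    rw [Function.update_self, Function.update_self, hq]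
  · rw [Function.update_of_ne hm, Function.update_of_ne hm, mul_one]
    exact (Matrix.mem_unitaryGroup_iff.1 (hV m)).symm

theorem gibbsState_mem_compatibleStates_thermalValue (β : Fin n → ℝ) (l : Fin E.N) :
    gibbsState β (E.charge l) ∈ compatibleStates (E.thermalValue β l) (E.charge l) :=
  _root_.gibbsState_mem_compatibleStates (E.charge_comm l) β

theorem trace_compound_mul {β : Fin n → ℝ} {v : Fin n → ℝ} {Q : Fin n → Matrix ι ι ℂ}
    {ρ : Matrix ι ι ℂ} (hρ : ρ ∈ compatibleStates v Q)
    {σ : ∀ l, Matrix (Fin (E.dim l)) (Fin (E.dim l)) ℂ}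
    (hσ : ∀ l, σ l ∈ compatibleStates (E.thermalValue β l) (E.charge l)) (j : Fin n) :
    ((ρ ⊗ₖ tensorFamily σ) * (Q j ⊗ₖ (1 : Matrix E.Index E.Index ℂ))).trace = v j ∧
    ((ρ ⊗ₖ tensorFamily σ) * ((1 : Matrix ι ι ℂ) ⊗ₖ E.totalCharge j)).trace =
      ∑ l, (E.thermalValue β l j : ℂ) := by
  have h1 : (tensorFamily σ).trace = 1 := (IsDensityMatrix.tensorPi fun l => (hσ l).1).2
  rw [← Matrix.mul_kronecker_mul, ← Matrix.mul_kronecker_mul, Matrix.trace_kronecker,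
    Matrix.trace_kronecker, mul_one, mul_one, h1, hρ.1.2, mul_one, one_mul, hρ.2 j,
    E.trace_tensorFamily_mul_totalCharge fun l => (hσ l).1]
  exact ⟨rfl, Finset.sum_congr rfl fun l _ => (hσ l).2 j⟩

/-- In a suitable product basis, the generalised Gibbs ensemble of the system together with the
thermal environment is a Gibbs distribution, with parameters `β`, of rescaled charges on its
support. All compatible product states are supported there and have the same mean values of the
charges and of the rescaled charges. -/
theorem exists_rescaledCharges [Nonempty ι] {β : Fin n → ℝ} (hβ : ∀ j, β j ≠ 0)
    {Q : Fin n → Matrix ι ι ℂ} (hQ : IsCommutingObservables Q) {v : Fin n → ℝ} {γ : Matrix ι ι ℂ}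
    (hγ : IsGeneralisedGibbsEnsemble v Q γ) :
    ∃ V ∈ Matrix.unitaryGroup (ι × E.Index) ℂ, ∃ (θ : ι × E.Index → Fin n → ℝ)
      (g : ι × E.Index → ℝ), IsGibbsOnSupport β θ g ∧ ∑ x, g x = 1 ∧
      γ ⊗ₖ tensorFamily (fun l => gibbsState β (E.charge l)) =
        V * Matrix.diagonal (fun x => (g x : ℂ)) * Vᴴ ∧
      γ ∈ compatibleStates v Q ∧ ∃ c c' : Fin n → ℂ,
      ∀ ρ ∈ compatibleStates v Q, ∀ σ : ∀ l, Matrix (Fin (E.dim l)) (Fin (E.dim l)) ℂ,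
        (∀ l, σ l ∈ compatibleStates (E.thermalValue β l) (E.charge l)) →
        (∀ x, g x = 0 → (Vᴴ * (ρ ⊗ₖ tensorFamily σ) * V) x x = 0) ∧
        ∀ j, ((ρ ⊗ₖ tensorFamily σ) * E.compoundCharge Q j).trace = c j ∧
          ((ρ ⊗ₖ tensorFamily σ) *
            (V * Matrix.diagonal (fun x => (θ x j : ℂ)) * Vᴴ)).trace = c' j := by
  obtain ⟨VS, hVS, q, hq⟩ := hQ.exists_diagonal
  choose VE hVE qE hqE using fun l => (E.charge_comm l).exists_diagonal
  obtain ⟨g, hg0, hg1, hγg, ⟨μ, c, hc, hgμ⟩, hsupp⟩ := hγ.exists_weights hVS hq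
  have hVEu := tensorPi_mem_unitaryGroup hVE
  set V : Matrix (ι × E.Index) (ι × E.Index) ℂ := VS ⊗ₖ tensorPi VE
  have hVSS : VS * VSᴴ = 1 := Matrix.mem_unitaryGroup_iff.1 hVS
  have hVEE : tensorPi VE * (tensorPi VE)ᴴ = 1 := Matrix.mem_unitaryGroup_iff.1 hVEu
  have hQX : ∀ j, Q j ⊗ₖ (1 : Matrix E.Index E.Index ℂ) =
      V * Matrix.diagonal (fun x : ι × E.Index => (q x.1 j : ℂ)) * Vᴴ := by
    intro j
    have : Matrix.diagonal (fun x : ι × E.Index => (q x.1 j : ℂ)) =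
        Matrix.diagonal (fun i => (q i j : ℂ)) ⊗ₖ (1 : Matrix E.Index E.Index ℂ) := by
      rw [← Matrix.diagonal_one, Matrix.diagonal_kronecker_diagonal]
      simp
    rw [this, kronecker_conj, ← hq, mul_one, hVEE]
  have hEX : ∀ j, (1 : Matrix ι ι ℂ) ⊗ₖ E.totalCharge j =
      V * Matrix.diagonal (fun x : ι × E.Index => ((∑ l, qE l (x.2 l) j : ℝ) : ℂ)) * Vᴴ := by
    intro j
    have : Matrix.diagonal (fun x : ι × E.Index => ((∑ l, qE l (x.2 l) j : ℝ) : ℂ)) =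
        (1 : Matrix ι ι ℂ) ⊗ₖ
          Matrix.diagonal (fun a : E.Index => ((∑ l, qE l (a l) j : ℝ) : ℂ)) := by
      rw [← Matrix.diagonal_one, Matrix.diagonal_kronecker_diagonal]
      simp
    rw [this, kronecker_conj, ← E.totalCharge_eq_conj_diagonal hVE hqE, mul_one, hVSS]
  have hgibbs : tensorFamily (fun l => gibbsState β (E.charge l)) = tensorPi VE *
      Matrix.diagonal (fun a : E.Index => ∏ l, (gibbsWeight (qE l) β (a l) : ℂ)) *
        (tensorPi VE)ᴴ := by
    rw [← tensorPi_diagonal (κ := fun l => Fin (E.dim l))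
      (fun l i => (gibbsWeight (qE l) β i : ℂ)), tensorPi_conj]
    change tensorPi _ = _
    congr 1
    funext l
    exact gibbsState_of_diagonal (hVE l) (hqE l) β
  -- The factor `μ j / β j` turns the multipliers `μ` of the system into the common `β`, so one
  -- family of thermal qubits serves system and environment alike.
  set θ : ι × E.Index → Fin n → ℝ := fun x j => μ j / β j * q x.1 j + ∑ l, qE l (x.2 l) j with hθ
  have hdot : ∀ x, β ⬝ᵥ θ x = μ ⬝ᵥ q x.1 + ∑ l, β ⬝ᵥ qE l (x.2 l) := by
    intro x
    simp only [dotProduct, hθ, mul_add, Finset.sum_add_distrib, Finset.mul_sum]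
    congr 1
    · exact Finset.sum_congr rfl fun j _ => by field_simp [hβ j]
    · exact Finset.sum_comm
  set gX : ι × E.Index → ℝ := fun x => g x.1 * ∏ l, gibbsWeight (qE l) β (x.2 l) with hgX
  have hprod : ∀ a : E.Index, 0 < ∏ l, gibbsWeight (qE l) β (a l) := fun a =>
    Finset.prod_pos fun l _ => gibbsWeight_pos _ _ _
  refine ⟨V, Matrix.kronecker_mem_unitary hVS hVEu, θ, gX, ?_, ?_, ?_, ?_,
    fun j => v j + ∑ l, (E.thermalValue β l j : ℂ),
    fun j => ((μ j / β j : ℝ) : ℂ) * v j + ∑ l, (E.thermalValue β l j : ℂ), ?_⟩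
  · refine ⟨c / ∏ l, ∑ k, Real.exp (-(β ⬝ᵥ qE l k)),
      div_pos hc (Finset.prod_pos fun l _ => sum_exp_pos _ _), fun x => ?_⟩
    rcases hgμ x.1 with h | h
    · left
      simp [hgX, h]
    · right
      rw [hgX, hdot]
      simp only [h, gibbsWeight]
      rw [Finset.prod_div_distrib, ← Real.exp_sum, neg_add, Real.exp_add, Finset.sum_neg_distrib]
      ring
  · rw [Fintype.sum_prod_type]
    simp only [hgX, ← Finset.mul_sum]
    have : ∑ a : E.Index, ∏ l, gibbsWeight (qE l) β (a l) = 1 := by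
      have h := (Finset.prod_univ_sum (fun l => (Finset.univ : Finset (Fin (E.dim l))))
        fun l i => gibbsWeight (qE l) β i).symm
      rw [Fintype.piFinset_univ] at h
      rw [h]
      exact Finset.prod_eq_one fun l _ => sum_gibbsWeight _ _
    rw [this]
    simp [hg1]
  · have : Matrix.diagonal (fun x : ι × E.Index => (gX x : ℂ)) =
        Matrix.diagonal (fun i => (g i : ℂ)) ⊗ₖ
        Matrix.diagonal (fun a : E.Index => ∏ l, (gibbsWeight (qE l) β (a l) : ℂ)) := by
      rw [Matrix.diagonal_kronecker_diagonal]
      congr 1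
      funext x
      simp [hgX]
    rw [this, kronecker_conj, ← hγg, ← hgibbs]
  · refine ⟨?_, hγ.2⟩
    rw [hγg]
    exact (isDensityMatrix_diagonal hg0 hg1).conj hVS
  · intro ρ hρ σ hσ
    refine ⟨fun x hx => ?_, fun j => ?_⟩
    · have hgx : g x.1 = 0 := (mul_eq_zero.1 hx).resolve_right (hprod x.2).ne'
      have h := kronecker_conj VSᴴ ρ (tensorPi VE)ᴴ (tensorFamily σ)
      rw [Matrix.conjTranspose_conjTranspose, Matrix.conjTranspose_conjTranspose,
        ← Matrix.conjTranspose_kronecker, Matrix.conjTranspose_conjTranspose] at h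
      rw [h, Matrix.kroneckerMap_apply, hsupp ρ hρ x.1 hgx, zero_mul]
    · obtain ⟨h1, h2⟩ := E.trace_compound_mul hρ hσ j
      refine ⟨?_, ?_⟩
      · rw [compoundCharge, mul_add, Matrix.trace_add, h1, h2]
      · have h3 : Matrix.diagonal (fun x => (θ x j : ℂ)) = ((μ j / β j : ℝ) : ℂ) •
            Matrix.diagonal (fun x : ι × E.Index => (q x.1 j : ℂ)) +
            Matrix.diagonal (fun x : ι × E.Index => ((∑ l, qE l (x.2 l) j : ℝ) : ℂ)) := by
          rw [← Matrix.diagonal_smul, Matrix.diagonal_add]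
          congr 1
          funext x
          simp [hθ]
        rw [h3, mul_add, add_mul, Matrix.mul_smul, Matrix.smul_mul, ← hQX, ← hEX, mul_add,
          Matrix.mul_smul, Matrix.trace_add, Matrix.trace_smul, h1, h2, smul_eq_mul]

end ChargedEnvironment

/-! ### From microstate operations to macrostate operations. -/

section Equivalence

variable {ι : Type*} [Fintype ι] [DecidableEq ι] {n : ℕ}

theorem norm_trace_sub_mul_conj_diagonal_le {X : Type*} [Fintype X] [DecidableEq X]
    {V : Matrix X X ℂ} (hV : V ∈ Matrix.unitaryGroup X ℂ) {ω ω' : Matrix X X ℂ}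
    (hω : IsDensityMatrix ω) (hω' : IsDensityMatrix ω') {e : X → ℝ} (he : ∀ x, 0 ≤ e x) :
    ‖((ω - ω') * (V * Matrix.diagonal (fun x => (e x : ℂ)) * Vᴴ)).trace‖ ≤ 2 * ∑ x, e x := by
  have hd : ∀ {ρ : Matrix X X ℂ}, IsDensityMatrix ρ → IsDensityMatrix (Vᴴ * ρ * V) := by
    intro ρ hρ
    simpa [Matrix.star_eq_conjTranspose] using hρ.conj (Unitary.star_mem hV)
  rw [trace_mul_conj_diagonal, mul_sub, sub_mul, Finset.mul_sum]
  refine (norm_sum_le _ _).trans (Finset.sum_le_sum fun x _ => ?_)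
  rw [norm_mul, Matrix.sub_apply, Complex.norm_real, Real.norm_of_nonneg (he x)]
  refine mul_le_mul_of_nonneg_right ((norm_sub_le _ _).trans ?_) (he x)
  linarith [(hd hω).norm_apply_le_one x x, (hd hω').norm_apply_le_one x x]

/-- The generalised Gibbs ensemble of a macrostate is compatible with it, so macrostate operations
are in particular microstate operations. -/
theorem MacroReachable.microReachable {β v : Fin n → ℝ} {Q : Fin n → Matrix ι ι ℂ}
    {γ ρf : Matrix ι ι ℂ} (hγ : γ ∈ compatibleStates v Q) (h : MacroReachable β v Q ρf) :
    MicroReachable β Q γ ρf := by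
  intro ε hε ε' hε'
  obtain ⟨E, U, hU, H⟩ := h ε hε ε' hε'
  exact ⟨E, U, hU, H γ hγ _ fun l => E.gibbsState_mem_compatibleStates_thermalValue β l⟩

/-- Thermalise with respect to the rescaled charges, then apply the given `U`. All choices (`δ`,
`s`, the qubits) are made before the compatible state is known, which gives the required uniformity.
-/
theorem MicroReachable.macroReachable [Nonempty ι] (hn : 0 < n) {β : Fin n → ℝ}
    (hβ : ∀ j, β j ≠ 0) {Q : Fin n → Matrix ι ι ℂ} (hQ : IsCommutingObservables Q)
    {v : Fin n → ℝ} {γ : Matrix ι ι ℂ} (hγ : IsGeneralisedGibbsEnsemble v Q γ)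
    {ρf : Matrix ι ι ℂ} (h : MicroReachable β Q γ ρf) : MacroReachable β v Q ρf := by
  intro ε hε ε' hε'
  -- `ε / 2` makes the bound strict at `τ`, so that it persists nearby; `ε' / 4` is one of four
  -- contributions to the charge error.
  obtain ⟨E, U, hU, hI₁, hI₂⟩ := h (ε / 2) (half_pos hε) (ε' / 4) (by positivity)
  obtain ⟨V, hV, θ, g, hg, hg1, hτ, hγc, c, c', hcomp⟩ := E.exists_rescaledCharges hβ hQ hγ
  set τ := γ ⊗ₖ tensorFamily (fun l => gibbsState β (E.charge l))
  obtain ⟨-, hτc⟩ := hcomp γ hγc _ fun l => E.gibbsState_mem_compatibleStates_thermalValue β l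
  set C := E.compoundCharge Q
  set Θ : Fin n → Matrix (ι × E.Index) (ι × E.Index) ℂ := fun j =>
    V * Matrix.diagonal (fun x => (θ x j : ℂ)) * Vᴴ
  -- states close to the thermal one are transformed almost like it
  have hnear : ∀ᶠ ω in nhds τ, traceNorm (partialTraceRight (U * ω * Uᴴ) - ρf) ≤ ε ∧
      ∀ j, ‖(U * ω * Uᴴ * C j).trace - (U * τ * Uᴴ * C j).trace‖ ≤ ε' / 4 ∧
        ‖((τ - ω) * Θ j).trace‖ ≤ ε' / 4 := by
    have hconj : Continuous fun ω : Matrix (ι × E.Index) (ι × E.Index) ℂ => U * ω * Uᴴ :=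
      (continuous_const.matrix_mul continuous_id).matrix_mul continuous_const
    have h1 : Continuous fun ω => traceNorm (partialTraceRight (U * ω * Uᴴ) - ρf) :=
      continuous_traceNorm.comp ((continuous_partialTraceRight.comp hconj).sub continuous_const)
    refine ((h1.continuousAt.eventually_lt (continuousAt_const (y := ε)) ?_).mono
      fun _ h => le_of_lt h).and (Filter.eventually_all.2 fun j => ?_)
    · exact hI₁.trans_lt (half_lt_self hε)
    · have h2 : Continuous fun ω => ‖(U * ω * Uᴴ * C j).trace - (U * τ * Uᴴ * C j).trace‖ :=
        ((hconj.matrix_mul continuous_const).matrix_trace.sub continuous_const).norm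
      have h3 : Continuous fun ω => ‖((τ - ω) * Θ j).trace‖ :=
        ((continuous_const.sub continuous_id).matrix_mul continuous_const).matrix_trace.norm
      refine ((h2.continuousAt.eventually_lt (continuousAt_const (y := ε' / 4)) ?_).mono
        fun _ h => le_of_lt h).and
        ((h3.continuousAt.eventually_lt (continuousAt_const (y := ε' / 4)) ?_).mono
        fun _ h => le_of_lt h)
      · simpa using hε'
      · simpa using hε'
  have hVc : Continuous fun M : Matrix (ι × E.Index) (ι × E.Index) ℂ => V * M * Vᴴ :=
    (continuous_const.matrix_mul continuous_id).matrix_mul continuous_const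
  rw [hτ] at hnear
  -- In the eigenbasis, closeness to `τ` becomes entrywise closeness to `diagonal g`. Half of `δ` is
  -- spent on perturbing `g`, half on imperfect thermalisation.
  obtain ⟨δ, hδ, hnear⟩ := exists_entrywise_of_eventually (hVc.tendsto _ |>.eventually hnear)
  rw [← hτ] at hnear
  -- perturb the charges to make them nondegenerate
  set e : ι × E.Index → ℝ := fun x => ((Fintype.equivFin _ x : ℕ) : ℝ)
  have he : Function.Injective e := fun x y h =>
    (Fintype.equivFin _).injective (Fin.ext (Nat.cast_injective h))
  have he0 : ∀ x, 0 ≤ e x := fun x => Nat.cast_nonneg _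
  obtain ⟨s, hs_inj, hs_g, hs⟩ : ∃ s : ℝ, Function.Injective (perturbedCharge θ e s) ∧
      (∀ x, |perturbedWeight g e (∑ j, β j) s x - g x| ≤ δ / 2) ∧
      |s| * (2 * ∑ x, e x) ≤ ε' / 4 := by
    have h1 : ∀ᶠ s in nhds (0 : ℝ),
        ∀ x, |perturbedWeight g e (∑ j, β j) s x - g x| ≤ δ / 2 := by
      refine Filter.eventually_all.2 fun x => ?_
      have := (tendsto_perturbedWeight hg1 e (∑ j, β j) x).eventually
        (Metric.closedBall_mem_nhds _ (half_pos hδ))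
      simpa [Metric.mem_closedBall, Real.dist_eq] using this
    have h2 : ∀ᶠ s in nhds (0 : ℝ), |s| * (2 * ∑ x, e x) ≤ ε' / 4 := by
      have hc : Continuous fun s : ℝ => |s| * (2 * ∑ x, e x) := by fun_prop
      refine (hc.continuousAt.eventually_lt (continuousAt_const (y := ε' / 4)) ?_).mono
        fun _ h => le_of_lt h
      simpa using hε'
    exact ((eventually_perturbedCharge_injective hn θ he).and
      ((h1.and h2).filter_mono nhdsWithin_le_nhds)).exists
  obtain ⟨hgs, hgs1, hgs0⟩ := perturbedWeight_properties hg hg1 e s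
  obtain ⟨L, _, _, x, hx, W, hW, hWc, hWt⟩ :=
    QubitAchievable.thermalisation hn hgs hs_inj hgs1 (half_pos hδ)
  set G := ((U * V) ⊗ₖ (1 : Matrix (L → Fin 2) (L → Fin 2) ℂ) * W * (Vᴴ ⊗ₖ 1))
  have hG : G ∈ Matrix.unitaryGroup ((ι × E.Index) × (L → Fin 2)) ℂ :=
    mul_mem (mul_mem (kronecker_one_mem_unitaryGroup (mul_mem hU hV)) hW)
      (kronecker_one_mem_unitaryGroup (Unitary.star_mem hV))
  refine ⟨E.addQubits x, G.submatrix (splitEquiv ι (E.addQubitsIndex x))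
    (splitEquiv ι (E.addQubitsIndex x)), submatrix_mem_unitaryGroup _ hG, ?_⟩
  intro ρ hρ σ hσ
  obtain ⟨ς, κ, hς, hκ, hσeq⟩ := E.mem_compatibleStates_addQubits hx hσ
  obtain ⟨hsupp, hωc⟩ := hcomp ρ hρ ς hς
  set ω := ρ ⊗ₖ tensorFamily ς
  have hω : IsDensityMatrix ω := hρ.1.kronecker (IsDensityMatrix.tensorPi fun l => (hς l).1)
  have hω₀ : IsDensityMatrix (Vᴴ * ω * V) := by
    simpa [Matrix.star_eq_conjTranspose] using hω.conj (Unitary.star_mem hV)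
  obtain ⟨Ξ, hΞ⟩ : ∃ Ξ, Ξ = W * ((Vᴴ * ω * V) ⊗ₖ tensorPi κ) * Wᴴ := ⟨_, rfl⟩
  have hΞd : IsDensityMatrix Ξ := hΞ ▸ hω₀.qubit_evolution hW fun l => (hκ l).1
  set ω₁ := V * partialTraceRight Ξ * Vᴴ with hω₁
  have hω₁d : IsDensityMatrix ω₁ := hΞd.partialTraceRight.conj hV
  have hclose : ∀ y z, ‖partialTraceRight Ξ y z -
      Matrix.diagonal (fun x => (g x : ℂ)) y z‖ ≤ δ := by
    intro y z
    have h1 := hWt _ hω₀ κ hκ (fun y hy => hsupp y (hgs0 y hy)) y z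
    rw [← hΞ] at h1
    have h2 : ‖Matrix.diagonal (fun x => (perturbedWeight g e (∑ j, β j) s x : ℂ)) y z -
        Matrix.diagonal (fun x => (g x : ℂ)) y z‖ ≤ δ / 2 := by
      by_cases hyz : y = z
      · subst hyz
        rw [Matrix.diagonal_apply_eq, Matrix.diagonal_apply_eq, ← Complex.ofReal_sub,
          Complex.norm_real]
        exact hs_g y
      · rw [Matrix.diagonal_apply_ne _ hyz, Matrix.diagonal_apply_ne _ hyz, sub_zero, norm_zero]
        exact (half_pos hδ).le
    calc _ ≤ _ := norm_sub_le_norm_sub_add_norm_sub _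
          (Matrix.diagonal (fun x => (perturbedWeight g e (∑ j, β j) s x : ℂ)) y z) _
      _ ≤ δ / 2 + δ / 2 := add_le_add h1 h2
      _ = δ := add_halves δ
  obtain ⟨hn₁, hn₂⟩ := hnear _ hclose
  have hfinal := thermalise_then_apply_eq U V W ω (tensorPi κ) hΞ
  refine E.implements_addQubits (ω := ω) (T := tensorPi κ) ?_ ?_ fun j => ?_
  · rw [hσeq]
    exact kronecker_submatrix _ _ _ _
  · rw [hfinal, partialTraceRight_conj_kronecker_one, Matrix.conjTranspose_mul]
    have : U * V * partialTraceRight Ξ * (Vᴴ * Uᴴ) = U * ω₁ * Uᴴ := by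
      simp only [hω₁, mul_assoc]
    rw [this]
    exact hn₁
  · have hpert : V * Matrix.diagonal (fun x => (perturbedCharge θ e s x j : ℂ)) * Vᴴ =
        Θ j + (s : ℂ) • (V * Matrix.diagonal (fun x => (e x : ℂ)) * Vᴴ) := by
      have : Matrix.diagonal (fun x => (perturbedCharge θ e s x j : ℂ)) =
          Matrix.diagonal (fun x => (θ x j : ℂ)) +
            (s : ℂ) • Matrix.diagonal (fun x => (e x : ℂ)) := by
        rw [← Matrix.diagonal_smul, Matrix.diagonal_add]
        congr 1
        funext x
        simp [perturbedCharge]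
      rw [this, mul_add, add_mul, Matrix.mul_smul, Matrix.smul_mul]
    have hT : (tensorPi κ).trace = 1 := (IsDensityMatrix.tensorPi fun l => (hκ l).1).2
    have hchange := trace_charge_change (t := fun x => (perturbedCharge θ e s x j : ℂ))
      (c := fun a => (qubitCharge x a j : ℂ)) hU hV hW (hWc j) (C j) ω hT hΞ hω₁
    rw [hfinal, hchange, hpert]
    have hτj := hI₂ j
    obtain ⟨hb₁, hb₂⟩ := hn₂ j
    have hb₃ : ‖(s : ℂ) * ((ω - ω₁) *
        (V * Matrix.diagonal (fun x => (e x : ℂ)) * Vᴴ)).trace‖ ≤ ε' / 4 := by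
      rw [norm_mul, Complex.norm_real, Real.norm_eq_abs]
      exact (mul_le_mul_of_nonneg_left
        (norm_trace_sub_mul_conj_diagonal_le hV hω hω₁d he0) (abs_nonneg s)).trans hs
    -- `ω` and `τ` have the same means of `C j` and `Θ j`, so `ω` can be traded for `τ`. The four
    -- terms are the deviation of `ω₁` from `τ` under `U`, the error of `U` on `τ` itself, the drift
    -- of `Θ j`, and the cost of lifting degeneracies.
    have hsplit : (U * ω₁ * Uᴴ * C j).trace - (ω * C j).trace +
        ((ω - ω₁) * (Θ j + (s : ℂ) • (V * Matrix.diagonal (fun x => (e x : ℂ)) * Vᴴ))).trace =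
        ((U * ω₁ * Uᴴ * C j).trace - (U * τ * Uᴴ * C j).trace) +
        ((U * τ * Uᴴ * C j).trace - (τ * C j).trace) + ((τ - ω₁) * Θ j).trace +
        (s : ℂ) * ((ω - ω₁) * (V * Matrix.diagonal (fun x => (e x : ℂ)) * Vᴴ)).trace := by
      rw [mul_add, Matrix.trace_add, Matrix.mul_smul, Matrix.trace_smul, smul_eq_mul,
        sub_mul ω ω₁ (Θ j), sub_mul τ ω₁ (Θ j), Matrix.trace_sub, Matrix.trace_sub,
        (hωc j).1, (hωc j).2, (hτc j).1, (hτc j).2]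
      ring
    rw [hsplit]
    refine (norm_add_le _ _).trans ((add_le_add ((norm_add_le _ _).trans
      (add_le_add (norm_add_le _ _) le_rfl)) le_rfl).trans ?_)
    linarith

end Equivalence

end

theorem theorem2 {ι : Type*} [Fintype ι] [DecidableEq ι] [Nonempty ι]
    {n : ℕ} (hn : 0 < n) (β : Fin n → ℝ) (hβ : ∀ j, β j ≠ 0)
    (Q : Fin n → Matrix ι ι ℂ) (hQ : IsCommutingObservables Q)
    (v : Fin n → ℝ) (γ : Matrix ι ι ℂ) (hγ : IsGeneralisedGibbsEnsemble v Q γ) :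
    OperationallyEquivalent β v Q γ := by
  intro ρf _
  refine ⟨fun h => h.microReachable ?_, fun h => h.macroReachable hn hβ hQ hγ⟩
  obtain ⟨V, hV, q, hq⟩ := hQ.exists_diagonal
  obtain ⟨g, hg0, hg1, hγg, -⟩ := hγ.exists_weights hV hq
  exact ⟨hγg ▸ (isDensityMatrix_diagonal hg0 hg1).conj hV, hγ.2⟩
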